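/- Let $G$ be a (discrete) group with a bound on the orders of its finite subgroups, and let $\operatorname{lcm}(G)$ be the least common multiple of these orders. Let $K\subseteq\mathbb{C}$ be a subring whose field of fractions $F\subseteq\mathbb{C}$ is closed under complex conjugation. Let $\mathcal{N}(G)\subseteq\mathcal{B}(\ell^2(G))$ be the group von Neumann algebra, generated by the left translations; let $\operatorname{tr}_G(a)=\langle a\delta_e,\delta_e\rangle$ be its canonical trace, and let $\operatorname{tr}^u\colon\mathcal{N}(G)\to\mathcal{Z}(\mathcal{N}(G))$ be its center-valued trace, i.e. the unique $\mathbb{C}$-linear map such that $\operatorname{tr}^u(ab)=\operatorname{tr}^u(ba)$ for all $a,b\in\mathcal{N}(G)$, $\operatorname{tr}^u(c)=c$ for all central $c$, and $\operatorname{tr}^u(a)\ge 0$ whenever $a\ge 0$. Extend both traces to $\operatorname{Mat}_n(\mathcal{N}(G))$ by summing over the diagonal entries. A matrix $A\in\operatorname{Mat}_n(K[G])$ acts on $\ell^2(G)^n$ as a bounded operator by left convolution multiplication; with $\operatorname{pr}_{\ker A}\in\operatorname{Mat}_n(\mathcal{N}(G))$ the orthogonal projection onto its kernel, put $\dim_G(\ker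 A)=\operatorname{tr}_G(\operatorname{pr}_{\ker A})$ and $\dim^u(\ker A)=\operatorname{tr}^u(\operatorname{pr}_{\ker A})$. Let $L_K(G)\subseteq\mathcal{Z}(\mathcal{N}(G))$ be the additive subgroup generated by the elements $\operatorname{tr}^u(P)$, where $P$ runs through the projections ($P=P^2=P^*$) in $F[H]$ and $H$ through the finite subgroups of $G$. Suppose that $G$ satisfies the center-valued Atiyah conjecture over $K$, i.e. that $\dim^u(\ker A)\in L_K(G)$ for every $n\in\mathbb{N}$ and every $A\in\operatorname{Mat}_n(K[G])$. Then $G$ satisfies the strong Atiyah conjecture over $K$, i.e. $$\dim_G(\ker A)\in\frac{1}{\operatorname{lcm}(G)}\mathbb{Z}$$ for every $n\in\mathbb{N}$ and every $A\in\operatorname{Mat}_n(K[G])$. -/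

import Mathlib

noncomputable section

namespace CenterAtiyah

universe u

/-! ### Finite subgroups -/

/-- There is a bound on the orders of the finite subgroups of `G`. -/
def BoundedFiniteSubgroups (G : Type u) [Group G] : Prop :=
  ∃ B : ℕ, ∀ H : Subgroup G, Finite H → Nat.card H ≤ B

/-- The least common multiple of the orders of the finite subgroups of `G`: the least positive
integer divisible by all of them. It is used only for groups with a bound on these orders, where
such a positive integer exists. -/
def lcmFin (G : Type u) [Group G] : ℕ :=
  sInf {m : ℕ | 0 < m ∧ ∀ H : Subgroup G, Finite H → Nat.card H ∣ m}

/-! ### The Hilbert space `ℓ²(G)` and the left regular representation -/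

/-- The Hilbert space `ℓ²(G)`. -/
abbrev L2 (G : Type u) : Type u := lp (fun _ : G => ℂ) 2

/-- The algebra of bounded operators on `ℓ²(G)`. -/
abbrev BL2 (G : Type u) : Type u := L2 G →L[ℂ] L2 G

open Classical in
/-- The basis vector `δ_g` of `ℓ²(G)`. -/
def delta {G : Type u} (g : G) : L2 G := lp.single 2 g (1 : ℂ)

theorem memℓp_translate {G : Type u} [Group G] (g : G) (f : L2 G) :
    Memℓp (fun h : G => (f : G → ℂ) (g⁻¹ * h)) 2 := by
  have hp : 0 < (2 : ENNReal).toReal := by simp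
  have hs := (lp.memℓp f).summable hp
  exact memℓp_gen ((Equiv.mulLeft g⁻¹).summable_iff.mpr hs)

/-- Left translation by `g` as a linear isometry of `ℓ²(G)`: `(λ_g f)(h) = f(g⁻¹h)`, so that
`λ_g δ_h = δ_{gh}`. -/
def leftTranslation {G : Type u} [Group G] (g : G) : L2 G →ₗᵢ[ℂ] L2 G where
  toFun f := ⟨fun h => (f : G → ℂ) (g⁻¹ * h), memℓp_translate g f⟩
  map_add' _ _ := rfl
  map_smul' _ _ := rfl
  norm_map' f := by
    have hp : 0 < (2 : ENNReal).toReal := by simp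
    rw [← Real.rpow_left_inj (norm_nonneg _) (norm_nonneg _) hp.ne',
      lp.norm_rpow_eq_tsum hp, lp.norm_rpow_eq_tsum hp]
    exact (Equiv.mulLeft g⁻¹).tsum_eq (fun h => ‖(f : G → ℂ) h‖ ^ (2 : ENNReal).toReal)

/-- The left regular representation of `G` on `ℓ²(G)`. -/
def leftRegular (G : Type u) [Group G] : G →* BL2 G where
  toFun g := (leftTranslation g).toContinuousLinearMap
  map_one' := by
    ext f h
    change (f : G → ℂ) (1⁻¹ * h) = (f : G → ℂ) h
    simp
  map_mul' a b := by
    ext f h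
    change (f : G → ℂ) ((a * b)⁻¹ * h) = (f : G → ℂ) (b⁻¹ * (a⁻¹ * h))
    simp [mul_assoc]

/-! ### The group von Neumann algebra -/

/-- The group von Neumann algebra of `G`: the von Neumann algebra on `ℓ²(G)` generated by the left
regular representation, that is, its double commutant. -/
def groupVN (G : Type u) [Group G] : VonNeumannAlgebra (L2 G) where
  toStarSubalgebra := StarSubalgebra.centralizer ℂ
    (StarSubalgebra.centralizer ℂ (Set.range (leftRegular G)) : Set (BL2 G))
  centralizer_centralizer' := by
    change Set.centralizer (Set.centralizer
      ((StarSubalgebra.centralizer ℂ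
        (StarSubalgebra.centralizer ℂ (Set.range (leftRegular G)) : Set (BL2 G)) :
          StarSubalgebra ℂ (BL2 G)) : Set (BL2 G))) =
      ((StarSubalgebra.centralizer ℂ
        (StarSubalgebra.centralizer ℂ (Set.range (leftRegular G)) : Set (BL2 G)) :
          StarSubalgebra ℂ (BL2 G)) : Set (BL2 G))
    rw [StarSubalgebra.coe_centralizer_centralizer, Set.centralizer_centralizer_centralizer]

/-- The underlying *-algebra `N(G)` of the group von Neumann algebra. -/
abbrev NG (G : Type u) [Group G] : Type u := (groupVN G).toStarSubalgebra

theorem mem_groupVN {G : Type u} [Group G] {a : BL2 G} :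
    a ∈ (groupVN G).toStarSubalgebra ↔
      ∀ T ∈ StarSubalgebra.centralizer ℂ (Set.range (leftRegular G)), T * a = a * T := by
  change a ∈ StarSubalgebra.centralizer ℂ
    (StarSubalgebra.centralizer ℂ (Set.range (leftRegular G)) : Set (BL2 G)) ↔ _
  rw [StarSubalgebra.mem_centralizer_iff]
  exact ⟨fun h T hT => (h T hT).1, fun h T hT => ⟨h T hT, h _ (star_mem hT)⟩⟩

theorem leftRegular_mem {G : Type u} [Group G] (g : G) :
    leftRegular G g ∈ (groupVN G).toStarSubalgebra := by
  rw [mem_groupVN]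
  intro T hT
  exact ((StarSubalgebra.mem_centralizer_iff ℂ).mp hT _ ⟨g, rfl⟩).1.symm

/-- The left regular representation with values in `N(G)`. -/
def leftRegularVN (G : Type u) [Group G] : G →* NG G :=
  (leftRegular G).codRestrict (groupVN G).toStarSubalgebra leftRegular_mem

/-- The embedding `R[G] → N(G)`, for a subring `R` of `ℂ`: group ring elements act on `ℓ²(G)` by
left convolution multiplication. -/
def groupRingToVN (G : Type u) [Group G] (R : Subring ℂ) : MonoidAlgebra R G →+* NG G :=
  ((MonoidAlgebra.lift ℂ (NG G) G (leftRegularVN G)) : MonoidAlgebra ℂ G →+* NG G).comp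
    (MonoidAlgebra.mapRingHom G R.subtype)

/-! ### Matrices over `N(G)` as operators on `ℓ²(G)ⁿ` -/

/-- The Hilbert space `ℓ²(G)ⁿ`. -/
abbrev L2n (G : Type u) (n : ℕ) : Type u := PiLp 2 (fun _ : Fin n => L2 G)

/-- The inclusion of the `j`-th summand into `ℓ²(G)ⁿ`. -/
def incl (G : Type u) {n : ℕ} (j : Fin n) : L2 G →L[ℂ] L2n G n :=
  ((PiLp.continuousLinearEquiv 2 ℂ (fun _ : Fin n => L2 G)).symm : _ →L[ℂ] L2n G n).comp
    (ContinuousLinearMap.single ℂ (fun _ : Fin n => L2 G) j)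

/-- The projection of `ℓ²(G)ⁿ` to the `i`-th summand. -/
def coord (G : Type u) {n : ℕ} (i : Fin n) : L2n G n →L[ℂ] L2 G :=
  PiLp.proj 2 (fun _ : Fin n => L2 G) i

/-- The bounded operator `(x_j)_j ↦ (∑ j, T i j x_j)_i` on `ℓ²(G)ⁿ` given by a matrix `T` over
`N(G)`. -/
def matrixOp {G : Type u} [Group G] {n : ℕ} (T : Matrix (Fin n) (Fin n) (NG G)) :
    L2n G n →L[ℂ] L2n G n :=
  ∑ i, ∑ j, (incl G i).comp ((T i j : BL2 G).comp (coord G j))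

/-- The orthogonal projection of `ℓ²(G)ⁿ` onto the kernel of the operator given by `T`. -/
def kerProjOp {G : Type u} [Group G] {n : ℕ} (T : Matrix (Fin n) (Fin n) (NG G)) :
    L2n G n →L[ℂ] L2n G n :=
  (LinearMap.ker (matrixOp T : L2n G n →ₗ[ℂ] L2n G n)).starProjection

theorem coord_incl (G : Type u) {n : ℕ} (i j : Fin n) (x : L2 G) :
    coord G i (incl G j x) = if i = j then x else 0 := by
  change (Pi.single j x : Fin n → L2 G) i = _
  by_cases h : i = j
  · subst h; simp
  · simp [h]

theorem matrixOp_apply {G : Type u} [Group G] {n : ℕ} (T : Matrix (Fin n) (Fin n) (NG G))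
    (x : L2n G n) (i : Fin n) : coord G i (matrixOp T x) = ∑ j, (T i j : BL2 G) (x j) := by
  simp only [matrixOp, _root_.sum_apply, map_sum, ContinuousLinearMap.comp_apply,
    coord_incl]
  simp [Finset.sum_ite_eq, coord]

/-- A bounded operator on `ℓ²(G)` acting diagonally on `ℓ²(G)ⁿ`. -/
def diagOp {G : Type u} (n : ℕ) (S : BL2 G) : L2n G n →L[ℂ] L2n G n :=
  ∑ i, (incl G i).comp (S.comp (coord G i))

theorem diagOp_apply {G : Type u} {n : ℕ} (S : BL2 G) (x : L2n G n) (i : Fin n) :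
    coord G i (diagOp n S x) = S (coord G i x) := by
  simp only [diagOp, _root_.sum_apply, map_sum, ContinuousLinearMap.comp_apply,
    coord_incl]
  simp [Finset.sum_ite_eq]

theorem ext_coord {G : Type u} {n : ℕ} {x y : L2n G n} (h : ∀ i, coord G i x = coord G i y) :
    x = y := PiLp.ext h

theorem inner_diagOp {G : Type u} {n : ℕ} (S : BL2 G) (x y : L2n G n) :
    inner ℂ (diagOp n S x) y = inner ℂ x (diagOp n (star S) y) := by
  rw [PiLp.inner_apply, PiLp.inner_apply]
  refine Finset.sum_congr rfl fun i _ => ?_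
  change inner ℂ (coord G i (diagOp n S x)) (coord G i y) =
    inner ℂ (coord G i x) (coord G i (diagOp n (star S) y))
  rw [diagOp_apply, diagOp_apply, ContinuousLinearMap.star_eq_adjoint,
    ContinuousLinearMap.adjoint_inner_right]

theorem diagOp_mem_ker {G : Type u} [Group G] {n : ℕ} (T : Matrix (Fin n) (Fin n) (NG G))
    {S : BL2 G} (hS : S ∈ StarSubalgebra.centralizer ℂ (Set.range (leftRegular G)))
    {x : L2n G n} (hx : matrixOp T x = 0) : matrixOp T (diagOp n S x) = 0 := by
  apply ext_coord
  intro i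
  have h1 : ∀ j, (T i j : BL2 G) ((diagOp n S x) j) = S ((T i j : BL2 G) (x j)) := by
    intro j
    have h2 : (diagOp n S x) j = S (x j) := diagOp_apply S x j
    rw [h2]
    exact (congrArg (fun R : BL2 G => R (x j)) (mem_groupVN.mp (T i j).2 S hS)).symm
  rw [matrixOp_apply]
  simp only [h1]
  rw [← map_sum, ← matrixOp_apply, hx]
  simp

theorem kerProjOp_diagOp {G : Type u} [Group G] {n : ℕ} (T : Matrix (Fin n) (Fin n) (NG G))
    {S : BL2 G} (hS : S ∈ StarSubalgebra.centralizer ℂ (Set.range (leftRegular G)))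
    (x : L2n G n) : kerProjOp T (diagOp n S x) = diagOp n S (kerProjOp T x) := by
  refine Submodule.eq_starProjection_of_mem_of_inner_eq_zero
    (K := LinearMap.ker (matrixOp T : L2n G n →ₗ[ℂ] L2n G n)) ?_ ?_
  · exact diagOp_mem_ker T hS (Submodule.starProjection_apply_mem
      (LinearMap.ker (matrixOp T : L2n G n →ₗ[ℂ] L2n G n)) x)
  · intro w hw
    rw [← map_sub, inner_diagOp]
    exact Submodule.starProjection_inner_eq_zero
      (K := LinearMap.ker (matrixOp T : L2n G n →ₗ[ℂ] L2n G n)) x _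
      (diagOp_mem_ker T (star_mem hS) hw)

theorem kerProj_entry_mem {G : Type u} [Group G] {n : ℕ} (T : Matrix (Fin n) (Fin n) (NG G))
    (i j : Fin n) :
    (coord G i).comp ((kerProjOp T).comp (incl G j)) ∈ (groupVN G).toStarSubalgebra := by
  rw [mem_groupVN]
  intro S hS
  ext1 x
  change S (coord G i (kerProjOp T (incl G j x))) = coord G i (kerProjOp T (incl G j (S x)))
  have h : incl G j (S x) = diagOp n S (incl G j x) := by
    apply ext_coord
    intro k
    rw [diagOp_apply, coord_incl, coord_incl]
    split_ifs <;> simp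
  rw [h, kerProjOp_diagOp T hS, diagOp_apply]

/-- The orthogonal projection onto the kernel of `T : ℓ²(G)ⁿ → ℓ²(G)ⁿ`, as a matrix over `N(G)`. -/
def kerProj {G : Type u} [Group G] {n : ℕ} (T : Matrix (Fin n) (Fin n) (NG G)) :
    Matrix (Fin n) (Fin n) (NG G) :=
  fun i j => ⟨(coord G i).comp ((kerProjOp T).comp (incl G j)), kerProj_entry_mem T i j⟩

/-! ### The canonical trace and the center-valued trace -/

/-- The canonical trace `a ↦ ⟨a δ_e, δ_e⟩` on `N(G)` (the inner product of Mathlib is linear in its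
second argument). -/
def trG {G : Type u} [Group G] (a : NG G) : ℂ :=
  inner ℂ (delta (1 : G)) ((a : BL2 G) (delta (1 : G)))

/-- The center of `N(G)`. -/
abbrev ZNG (G : Type u) [Group G] : Type u := Subalgebra.center ℂ (NG G)

/-- The defining properties of the center-valued trace on `N(G)`. -/
structure IsCenterValuedTrace {G : Type u} [Group G] (τ : NG G →ₗ[ℂ] ZNG G) : Prop where
  tracial : ∀ a b : NG G, τ (a * b) = τ (b * a)
  map_center : ∀ c : ZNG G, τ (c : NG G) = c
  positive : ∀ a : NG G, (a : BL2 G).IsPositive → ((τ a : NG G) : BL2 G).IsPositive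

open Classical in
/-- The center-valued trace `tr^u : N(G) → Z(N(G))`: the linear map with the properties of
`IsCenterValuedTrace`. By the classical theory of finite von Neumann algebras there is exactly one
such map, for every group `G`; the second branch is therefore never taken. -/
def trU (G : Type u) [Group G] : NG G →ₗ[ℂ] ZNG G :=
  if h : ∃ τ : NG G →ₗ[ℂ] ZNG G, IsCenterValuedTrace τ then h.choose else 0

/-- `dim_G (ker T) = tr_G (pr_{ker T})`, where `tr_G` is extended to matrices by the
(non-normalized) matrix trace. -/
def dimGKer {G : Type u} [Group G] {n : ℕ} (T : Matrix (Fin n) (Fin n) (NG G)) : ℂ :=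
  ∑ i, trG (kerProj T i i)

/-- `dim^u (ker T) = tr^u (pr_{ker T})`, where `tr^u` is extended to matrices by the
(non-normalized) matrix trace. -/
def dimUKer {G : Type u} [Group G] {n : ℕ} (T : Matrix (Fin n) (Fin n) (NG G)) : ZNG G :=
  ∑ i, trU G (kerProj T i i)

/-! ### The two conjectures -/

/-- The field of fractions, inside `ℂ`, of a subring `K` of `ℂ`. -/
def fracField (K : Subring ℂ) : Subfield ℂ := Subfield.closure (K : Set ℂ)

/-- The additive subgroup `L_K(G)` of the center of `N(G)` generated by the `tr^u(P)`, where `P` runs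
through the projections in `F[H]`, `H` through the finite subgroups of `G`, and `F` is the field of
fractions of `K`. -/
def LK (K : Subring ℂ) (G : Type u) [Group G] : AddSubgroup (ZNG G) :=
  AddSubgroup.closure {z | ∃ H : Subgroup G, Finite H ∧
    ∃ p : MonoidAlgebra (fracField K).toSubring H, ∃ P : NG G,
      P = groupRingToVN G (fracField K).toSubring (MonoidAlgebra.mapDomainRingHom _ H.subtype p) ∧
      IsStarProjection P ∧ z = trU G P}

/-- The center-valued Atiyah conjecture over `K` for `G`. (It is considered for groups with a bound
on the orders of finite subgroups, and for `K` whose field of fractions is closed under complex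
conjugation.) -/
def CenterValuedAtiyahConjecture (K : Subring ℂ) (G : Type u) [Group G] : Prop :=
  ∀ (n : ℕ) (A : Matrix (Fin n) (Fin n) (MonoidAlgebra K G)),
    dimUKer (A.map (groupRingToVN G K)) ∈ LK K G

/-- The strong Atiyah conjecture over `K` for `G`. (It is considered for groups with a bound on the
orders of finite subgroups.) -/
def StrongAtiyahConjecture (K : Subring ℂ) (G : Type u) [Group G] : Prop :=
  ∀ (n : ℕ) (A : Matrix (Fin n) (Fin n) (MonoidAlgebra K G)),
    ∃ k : ℤ, dimGKer (A.map (groupRingToVN G K)) = (1 / (lcmFin G : ℂ)) * (k : ℂ)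

end CenterAtiyah

end

/-! The canonical trace factors through the center-valued one: `trG (trU G a) = trG a` (`trG_trU`).
Hence `dim_G(ker A)` is the canonical trace of `dim^u(ker A)`, and it is enough to know that trace
on the generators of `L_K(G)`. For a projection P in F[H] with H finite, `trG P` is the coefficient
at 1 of an idempotent of ℂ[H]. Left multiplication by this idempotent has integral trace, equal to
|H| times that coefficient, so `lcmFin G * trG P` is an integer.

The work lies in the factorization. Since `trU` is chosen among all maps with the defining
properties, two facts are needed.

Existence. Identify a ∈ N(G) with the vector `vec a` = aδ_e. Central elements are those whose vector
is invariant under conjugation, and the orthogonal projection onto invariant vectors maps N(G) to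
its center: the projected vector is a limit of vectors of elements in the same norm ball, and such
balls are closed by weak compactness. The resulting expectation `centerExp` is a center-valued
trace.

Uniqueness. A positive tracial functional φ equal to `trG` on the center equals `trG` everywhere
(`ExtendsCentralTrace.eq_trG`); this is applied to `trG ∘ trU`. No continuity of φ is assumed.
Comparison of projections bounds φ(p) by n·tr(p) + 1/n, so that φ is ‖·‖₂-continuous on norm balls.
As `centerExp G a` is a ‖·‖₂-limit of bounded elements on which φ takes the value φ(a), it follows
that φ(a) = `trG a`. -/

noncomputable section

namespace CenterAtiyah

universe u

open scoped ComplexOrder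

/-! ### Vectors of elements of N(G) and the canonical trace -/

section Basics

variable {G : Type u}

theorem inner_delta (g : G) (f : L2 G) : inner ℂ (delta g) f = f g := by
  classical
  rw [delta, lp.inner_single_left]
  simp

theorem delta_apply_self (g : G) : (delta g : L2 G) g = 1 := by
  simp [delta]

theorem delta_apply_of_ne {g h : G} (hne : h ≠ g) : (delta g : L2 G) h = 0 := by
  simp [delta, hne]

theorem norm_delta (g : G) : ‖(delta g : L2 G)‖ = 1 := by
  classical
  rw [delta, lp.norm_single (by simp)]
  simp

theorem ext_inner_delta {x y : L2 G} (h : ∀ g, inner ℂ (delta g) x = inner ℂ (delta g) y) :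
    x = y := by
  ext g
  simpa only [inner_delta] using h g

/-- Bounded operators on `ℓ²(G)` are determined by their values on the basis vectors. -/
theorem ext_delta {S T : BL2 G} (h : ∀ g, S (delta g) = T (delta g)) : S = T := by
  -- The coefficient of S*x at g is ⟨Sδ_g, x⟩, so comparing adjoints replaces a density argument.
  have hadj : ∀ x, star S x = star T x := fun x => ext_inner_delta fun g => by
    rw [ContinuousLinearMap.star_eq_adjoint, ContinuousLinearMap.star_eq_adjoint,
      ContinuousLinearMap.adjoint_inner_right, ContinuousLinearMap.adjoint_inner_right, h]
  exact star_injective (ContinuousLinearMap.ext hadj)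

variable [Group G]

theorem leftRegular_apply (g h : G) (f : L2 G) : (leftRegular G g f) h = f (g⁻¹ * h) := rfl

theorem leftRegular_delta (g h : G) : leftRegular G g (delta h) = delta (g * h) := by
  ext k
  rw [leftRegular_apply]
  by_cases hk : k = g * h
  · subst hk
    simp [delta_apply_self]
  · rw [delta_apply_of_ne hk, delta_apply_of_ne]
    rintro rfl
    simp at hk

theorem norm_leftRegular_apply (g : G) (f : L2 G) : ‖leftRegular G g f‖ = ‖f‖ :=
  (leftTranslation g).norm_map f

theorem star_leftRegular (g : G) : star (leftRegular G g) = leftRegular G g⁻¹ := by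
  rw [ContinuousLinearMap.star_eq_adjoint, eq_comm, ContinuousLinearMap.eq_adjoint_iff]
  intro x y
  rw [← (leftTranslation g).inner_map_map]
  change inner ℂ (leftRegular G g (leftRegular G g⁻¹ x)) (leftRegular G g y) = _
  rw [← mul_apply_eq_comp, ← map_mul]
  simp

theorem memℓp_translate_right (g : G) (f : L2 G) :
    Memℓp (fun h : G => (f : G → ℂ) (h * g)) 2 := by
  have hp : 0 < (2 : ENNReal).toReal := by simp
  have hs := (lp.memℓp f).summable hp
  exact memℓp_gen ((Equiv.mulRight g).summable_iff.mpr hs)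

/-- Right translation by `g` as a linear isometry of `ℓ²(G)`: `(ρ_g f)(h) = f(hg)`. -/
def rightTranslation (g : G) : L2 G →ₗᵢ[ℂ] L2 G where
  toFun f := ⟨fun h => (f : G → ℂ) (h * g), memℓp_translate_right g f⟩
  map_add' _ _ := rfl
  map_smul' _ _ := rfl
  norm_map' f := by
    have hp : 0 < (2 : ENNReal).toReal := by simp
    rw [← Real.rpow_left_inj (norm_nonneg _) (norm_nonneg _) hp.ne',
      lp.norm_rpow_eq_tsum hp, lp.norm_rpow_eq_tsum hp]
    exact (Equiv.mulRight g).tsum_eq (fun h => ‖(f : G → ℂ) h‖ ^ (2 : ENNReal).toReal)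

/-- Right translation by `g` as a bounded operator. -/
def rightRegular (g : G) : BL2 G := (rightTranslation g).toContinuousLinearMap

theorem rightRegular_apply (g h : G) (f : L2 G) : (rightRegular g f) h = f (h * g) := rfl

theorem norm_rightRegular_apply (g : G) (f : L2 G) : ‖rightRegular g f‖ = ‖f‖ :=
  (rightTranslation g).norm_map f

theorem rightRegular_delta_one (g : G) : rightRegular g (delta 1 : L2 G) = delta g⁻¹ := by
  ext k
  rw [rightRegular_apply]
  by_cases hk : k = g⁻¹
  · subst hk
    simp [delta_apply_self]
  · rw [delta_apply_of_ne hk, delta_apply_of_ne]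
    exact fun h => hk (eq_inv_of_mul_eq_one_left h)

theorem mem_centralizer_leftRegular {T : BL2 G}
    (h : ∀ g, leftRegular G g * T = T * leftRegular G g) :
    T ∈ StarSubalgebra.centralizer ℂ (Set.range (leftRegular G)) := by
  rw [StarSubalgebra.mem_centralizer_iff]
  rintro _ ⟨g, rfl⟩
  rw [star_leftRegular]
  exact ⟨h g, h g⁻¹⟩

theorem rightRegular_mem_centralizer (g : G) :
    rightRegular g ∈ StarSubalgebra.centralizer ℂ (Set.range (leftRegular G)) := by
  refine mem_centralizer_leftRegular fun h => ?_
  ext f k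
  change f (h⁻¹ * k * g) = f (h⁻¹ * (k * g))
  rw [mul_assoc]

theorem rightRegular_comm (a : NG G) (g : G) (x : L2 G) :
    rightRegular g ((a : BL2 G) x) = (a : BL2 G) (rightRegular g x) :=
  congrArg (fun R : BL2 G => R x) (mem_groupVN.mp a.2 _ (rightRegular_mem_centralizer g))

/-- Right translations commute with N(G) and carry δ_e to every δ_g; this is why aδ_e determines a.
-/
theorem apply_delta (a : NG G) (g : G) :
    (a : BL2 G) (delta g) = rightRegular g⁻¹ ((a : BL2 G) (delta 1)) := by
  rw [rightRegular_comm, rightRegular_delta_one, inv_inv]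

/-- The vector `a δ_e` of an element `a` of `N(G)`. -/
def vec (a : NG G) : L2 G := (a : BL2 G) (delta 1)

/-- The vector `δ_e` is separating for `N(G)`. -/
theorem vec_injective : Function.Injective (vec : NG G → L2 G) := by
  intro a b h
  refine Subtype.ext (ext_delta fun g => ?_)
  rw [apply_delta a, apply_delta b]
  exact congrArg (rightRegular g⁻¹) h

/-- `a ↦ a δ_e` as a linear map. -/
def vecₗ (G : Type u) [Group G] : NG G →ₗ[ℂ] L2 G where
  toFun := vec
  map_add' _ _ := rfl
  map_smul' _ _ := rfl

@[simp] theorem vecₗ_apply (a : NG G) : vecₗ G a = vec a := rfl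

theorem vec_add (a b : NG G) : vec (a + b) = vec a + vec b := rfl
theorem vec_sub (a b : NG G) : vec (a - b) = vec a - vec b := rfl
theorem vec_smul (c : ℂ) (a : NG G) : vec (c • a) = c • vec a := rfl

theorem trG_eq (a : NG G) : trG a = vec a 1 := inner_delta _ _

theorem star_coe_inner (a : NG G) (x y : L2 G) :
    inner ℂ x (((star a : NG G) : BL2 G) y) = inner ℂ ((a : BL2 G) x) y := by
  change inner ℂ x ((star (a : BL2 G)) y) = _
  rw [ContinuousLinearMap.star_eq_adjoint, ContinuousLinearMap.adjoint_inner_right]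

theorem coe_inner_left (a : NG G) (x y : L2 G) :
    inner ℂ (((star a : NG G) : BL2 G) x) y = inner ℂ x ((a : BL2 G) y) := by
  rw [← star_coe_inner, star_star]

theorem vec_star_apply (a : NG G) (g : G) : vec (star a) g = star (vec a g⁻¹) := by
  rw [← inner_delta, vec, star_coe_inner, apply_delta, ← inner_conj_symm, inner_delta,
    rightRegular_apply, one_mul]
  rfl

theorem trG_mul (a b : NG G) : trG (a * b) = inner ℂ (vec (star a)) (vec b) := by
  rw [vec, vec, coe_inner_left]
  rfl

theorem trG_star_mul_self (a : NG G) : trG (star a * a) = (‖vec a‖ : ℂ) ^ 2 := by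
  rw [trG_mul, star_star, inner_self_eq_norm_sq_to_K]
  rfl

/-- Both sides are ∑ a(g⁻¹)b(g), up to the substitution g ↦ g⁻¹. -/
theorem trG_mul_comm (a b : NG G) : trG (a * b) = trG (b * a) := by
  rw [trG_mul, trG_mul, lp.inner_eq_tsum, lp.inner_eq_tsum, ← (Equiv.inv G).tsum_eq]
  refine tsum_congr fun g => ?_
  simp only [Equiv.inv_apply, vec_star_apply, inv_inv, RCLike.inner_apply, starRingEnd_apply,
    star_star]
  ring

/-- The canonical trace as a linear map. -/
def trGₗ (G : Type u) [Group G] : NG G →ₗ[ℂ] ℂ where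
  toFun := trG
  map_add' a b := by rw [trG_eq, trG_eq, trG_eq]; rfl
  map_smul' c a := by rw [trG_eq, trG_eq]; rfl

theorem trGₗ_apply (a : NG G) : trGₗ G a = trG a := rfl

theorem eq_zero_of_trG_star_mul_self {a : NG G} (h : trG (star a * a) = 0) : a = 0 := by
  rw [trG_star_mul_self] at h
  refine vec_injective ?_
  have : vec a = 0 := by simpa using h
  rw [this]
  rfl

theorem trG_nonneg {a : NG G} (h : (a : BL2 G).IsPositive) : 0 ≤ trG a :=
  h.inner_nonneg_right _

/-- An element of `N(G)` that commutes with the group is central. -/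
theorem mem_center_of_comm {c : NG G}
    (h : ∀ g, leftRegular G g * (c : BL2 G) = (c : BL2 G) * leftRegular G g) :
    c ∈ Subalgebra.center ℂ (NG G) := by
  rw [Subalgebra.mem_center_iff]
  intro b
  exact Subtype.ext (mem_groupVN.mp b.2 _ (mem_centralizer_leftRegular h)).symm

theorem center_comm {c : NG G} (hc : c ∈ Subalgebra.center ℂ (NG G)) (b : NG G) :
    b * c = c * b := Subalgebra.mem_center_iff.mp hc b

theorem star_mem_center {c : NG G} (hc : c ∈ Subalgebra.center ℂ (NG G)) :
    star c ∈ Subalgebra.center ℂ (NG G) := by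
  rw [Subalgebra.mem_center_iff]
  intro b
  have := congrArg star (center_comm hc (star b))
  simpa using this.symm

end Basics

/-! ### Weak operator compactness of balls in N(G) -/

section WeakCompactness

open Filter Topology ContinuousLinearMapWOT

variable {H : Type u} [NormedAddCommGroup H] [InnerProductSpace ℂ H] [CompleteSpace H]

theorem continuous_wot_inner (x y : H) : Continuous fun A : H →WOT[ℂ] H => inner ℂ y (A x) :=
  continuous_dual_apply x (InnerProductSpace.toDual ℂ H y)

/-- Norm-bounded nets of operators have cluster points in the weak operator topology. -/
theorem isCompact_wot_ball (M : ℝ) : IsCompact {A : H →WOT[ℂ] H | ‖A.toCLM‖ ≤ M} := by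
  rw [isCompact_iff_ultrafilter_le_nhds]
  intro U hU
  rw [le_principal_iff] at hU
  have hM : 0 ≤ M := by
    obtain ⟨A, hA⟩ := U.neBot.nonempty_of_mem hU
    exact (norm_nonneg _).trans hA
  have hbd : ∀ x y : H, ∀ᶠ A in (U : Filter (H →WOT[ℂ] H)),
      ‖inner ℂ (A x) y‖ ≤ M * ‖x‖ * ‖y‖ := fun x y => by
    filter_upwards [hU] with A hA
    refine (norm_inner_le_norm _ _).trans ?_
    gcongr
    exact (A.toCLM.le_opNorm x).trans (by gcongr)
  -- Each matrix coefficient stays in a closed disc, hence converges along the ultrafilter. The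
  -- limits form a bounded sesquilinear form, which the Riesz theorem represents by an operator.
  have hex : ∀ x y : H, ∃ c : ℂ, Tendsto (fun A : H →WOT[ℂ] H => inner ℂ (A x) y) U (𝓝 c) := by
    intro x y
    obtain ⟨c, -, hc⟩ := (isCompact_iff_ultrafilter_le_nhds.mp
      (isCompact_closedBall (0 : ℂ) (M * ‖x‖ * ‖y‖)))
      (U.map (fun A : H →WOT[ℂ] H => inner ℂ (A x) y)) (by
        rw [le_principal_iff]
        refine Ultrafilter.mem_map.mpr (Filter.mem_of_superset (hbd x y) fun A hA => ?_)
        simpa using hA)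
    exact ⟨c, hc⟩
  choose l hl using hex
  have huniq : ∀ {f : (H →WOT[ℂ] H) → ℂ} {a b : ℂ}, Tendsto f U (𝓝 a) → Tendsto f U (𝓝 b) →
      a = b := fun h1 h2 => tendsto_nhds_unique h1 h2
  let B₀ : H →ₗ⋆[ℂ] H →ₗ[ℂ] ℂ := LinearMap.mk₂'ₛₗ (starRingEnd ℂ) (RingHom.id ℂ) l
    (fun x x' y => huniq (hl _ y) (by
      simpa only [map_add, inner_add_left] using (hl x y).add (hl x' y)))
    (fun c x y => huniq (hl _ y) (by
      simpa only [map_smul, inner_smul_left, smul_eq_mul] using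
        (hl x y).const_mul ((starRingEnd ℂ) c)))
    (fun x y y' => huniq (hl x _) (by
      simpa only [inner_add_right] using (hl x y).add (hl x y')))
    (fun c x y => huniq (hl x _) (by
      simpa only [inner_smul_right, smul_eq_mul, RingHom.id_apply] using (hl x y).const_mul c))
  have hB₀ : ∀ x y, ‖B₀ x y‖ ≤ M * ‖x‖ * ‖y‖ := fun x y =>
    le_of_tendsto (hl x y).norm (hbd x y)
  let B : H →L⋆[ℂ] H →L[ℂ] ℂ := B₀.mkContinuous₂ M hB₀
  let b : H →L[ℂ] H := InnerProductSpace.continuousLinearMapOfBilin B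
  have hb : ∀ x y, inner ℂ (b x) y = l x y := fun x y =>
    InnerProductSpace.continuousLinearMapOfBilin_apply B x y
  refine ⟨ofCLM b, ?_, ?_⟩
  · refine ContinuousLinearMap.opNorm_le_bound _ hM fun x => ?_
    change ‖b x‖ ≤ _
    have h1 := hB₀ x (b x)
    change ‖l x (b x)‖ ≤ _ at h1
    rw [← hb, inner_self_eq_norm_sq_to_K] at h1
    have h2 : ‖b x‖ * ‖b x‖ ≤ M * ‖x‖ * ‖b x‖ := by simpa [sq] using h1
    by_cases h0 : ‖b x‖ = 0
    · rw [h0]; positivity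
    · exact le_of_mul_le_mul_right h2 (lt_of_le_of_ne (norm_nonneg _) (Ne.symm h0))
  · rw [le_nhds_iff_forall_inner_apply_le_nhds]
    intro x y
    have h := (Complex.continuous_conj.tendsto _).comp (hl x y)
    rw [← hb, inner_conj_symm] at h
    refine Tendsto.congr (fun A => ?_) h
    exact inner_conj_symm _ _

/-- Evaluating a weakly compact set of operators at a vector gives a closed set of vectors. -/
theorem isClosed_image_wot_apply {K : Set (H →WOT[ℂ] H)} (hK : IsCompact K) (x : H) :
    IsClosed ((fun A : H →WOT[ℂ] H => A x) '' K) := by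
  -- Vectors are embedded in the product ℂ^H by their inner products: there the image of `K` is
  -- compact, hence closed, and its preimage under the continuous `j` is norm closed.
  let j : H → H → ℂ := fun ξ y => inner ℂ y ξ
  have hj : Continuous j := continuous_pi fun y => by fun_prop
  have hinj : Function.Injective j := fun a b h => ext_inner_left ℂ fun y => congrFun h y
  have hc : Continuous fun A : H →WOT[ℂ] H => j (A x) :=
    continuous_pi fun y => continuous_wot_inner x y
  have h := ((hK.image hc).isClosed).preimage hj
  convert h using 1
  rw [← Set.image_image j, Set.preimage_image_eq _ hinj]

theorem isClosed_wot_isPositive : IsClosed {A : H →WOT[ℂ] H | A.toCLM.IsPositive} := by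
  have : {A : H →WOT[ℂ] H | A.toCLM.IsPositive} = ⋂ x : H, {A | 0 ≤ inner ℂ x (A x)} := by
    ext A
    simp only [Set.mem_ofPred_eq, Set.mem_iInter]
    refine ⟨fun h x => h.inner_nonneg_right x, fun h => ?_⟩
    rw [ContinuousLinearMap.isPositive_iff_complex]
    intro x
    have h1 := h x
    have h2 : 0 ≤ inner ℂ (A x) x := by
      rw [← inner_conj_symm]
      exact star_nonneg_iff.mpr h1
    have h3 := Complex.nonneg_iff.mp h2
    exact ⟨Complex.ext (by simp) (by simpa using h3.2), h3.1⟩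
  rw [this]
  exact isClosed_iInter fun x => isClosed_le continuous_const (continuous_wot_inner x x)

/-- The two-sided form covers both the commutation relations that cut out N(G) and the corner
equation fAe = A. -/
theorem isClosed_wot_mul_eq (S T S' T' : H →L[ℂ] H) :
    IsClosed {A : H →WOT[ℂ] H | S * A.toCLM * T = S' * A.toCLM * T'} := by
  have : {A : H →WOT[ℂ] H | S * A.toCLM * T = S' * A.toCLM * T'} =
      ⋂ x : H, ⋂ y : H, {A | inner ℂ (star S y) (A (T x)) = inner ℂ (star S' y) (A (T' x))} := by
    ext A
    simp only [Set.mem_ofPred_eq, Set.mem_iInter, ContinuousLinearMap.star_eq_adjoint,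
      ContinuousLinearMap.adjoint_inner_left]
    refine ⟨fun h x y => congrArg (fun R : H →L[ℂ] H => inner ℂ y (R x)) h, fun h => ?_⟩
    ext1 x
    exact ext_inner_left ℂ fun y => h x y
  rw [this]
  exact isClosed_iInter fun x => isClosed_iInter fun y =>
    isClosed_eq (continuous_wot_inner _ _) (continuous_wot_inner _ _)

variable {G : Type u} [Group G]

theorem isClosed_wot_groupVN :
    IsClosed {A : L2 G →WOT[ℂ] L2 G | A.toCLM ∈ (groupVN G).toStarSubalgebra} := by
  have : {A : L2 G →WOT[ℂ] L2 G | A.toCLM ∈ (groupVN G).toStarSubalgebra} =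
      ⋂ T ∈ StarSubalgebra.centralizer ℂ (Set.range (leftRegular G)),
        {A | T * A.toCLM * 1 = 1 * A.toCLM * T} := by
    ext A
    simp only [Set.mem_ofPred_eq, Set.mem_iInter, mul_one, one_mul]
    exact mem_groupVN
  rw [this]
  exact isClosed_biInter fun T _ => isClosed_wot_mul_eq T 1 1 T

theorem isCompact_wot_groupVN_ball (M : ℝ) :
    IsCompact {A : L2 G →WOT[ℂ] L2 G |
      ‖A.toCLM‖ ≤ M ∧ A.toCLM ∈ (groupVN G).toStarSubalgebra} :=
  (isCompact_wot_ball M).inter_right isClosed_wot_groupVN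

/-- Weak compactness ensures that an ℓ²-limit of vectors of uniformly bounded elements is again the
vector of an element of N(G). -/
theorem isClosed_vec_ball (M : ℝ) :
    IsClosed (vec '' {a : NG G | ‖(a : BL2 G)‖ ≤ M}) := by
  convert isClosed_image_wot_apply (isCompact_wot_groupVN_ball (G := G) M) (delta 1) using 1
  ext ξ
  constructor
  · rintro ⟨a, ha, rfl⟩
    exact ⟨ofCLM a, ⟨ha, a.2⟩, rfl⟩
  · rintro ⟨A, ⟨h1, h2⟩, rfl⟩
    exact ⟨⟨A.toCLM, h2⟩, h1, rfl⟩

theorem isClosed_vec_ball_isPositive (M : ℝ) :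
    IsClosed (vec '' {a : NG G | ‖(a : BL2 G)‖ ≤ M ∧ (a : BL2 G).IsPositive}) := by
  convert isClosed_image_wot_apply ((isCompact_wot_groupVN_ball (G := G) M).inter_right
    isClosed_wot_isPositive) (delta 1) using 1
  ext ξ
  constructor
  · rintro ⟨a, ha, rfl⟩
    exact ⟨ofCLM a, ⟨⟨ha.1, a.2⟩, ha.2⟩, rfl⟩
  · rintro ⟨A, ⟨⟨h1, h2⟩, h3⟩, rfl⟩
    exact ⟨⟨A.toCLM, h2⟩, ⟨h1, h3⟩, rfl⟩

end WeakCompactness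

/-! ### The conditional expectation onto the center -/

section ConditionalExpectation

/-- A nonempty closed convex set of a Hilbert space has a unique element of minimal norm. -/
theorem exists_unique_norm_minimal {H : Type u} [NormedAddCommGroup H] [InnerProductSpace ℂ H]
    [CompleteSpace H] {C : Set H} (hne : C.Nonempty) (hC : IsClosed C)
    (hconv : ∀ x ∈ C, ∀ y ∈ C, ∀ s t : ℝ, 0 ≤ s → 0 ≤ t → s + t = 1 →
      (s : ℂ) • x + (t : ℂ) • y ∈ C) :
    ∃ m ∈ C, ∀ x ∈ C, ‖x‖ = ‖m‖ → x = m := by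
  let : InnerProductSpace ℝ H := InnerProductSpace.complexToReal
  have hconv' : Convex ℝ C := by
    intro x hx y hy s t hs ht hst
    simpa only [Complex.coe_smul] using hconv x hx y hy s t hs ht hst
  obtain ⟨m, hm, hmin⟩ := exists_norm_eq_iInf_of_complete_convex hne hC.isComplete hconv' 0
  refine ⟨m, hm, fun x hx hxm => ?_⟩
  -- The variational inequality gives ‖m‖² ≤ Re⟨m, x⟩; for ‖x‖ = ‖m‖ this forces ‖x − m‖² ≤ 0.
  have h := (norm_eq_iInf_iff_real_inner_le_zero hconv' hm).mp hmin x hx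
  rw [zero_sub, inner_neg_left, inner_sub_right, real_inner_self_eq_norm_sq] at h
  have h2 := norm_sub_sq_real x m
  rw [real_inner_comm] at h2
  have h3 : ‖x - m‖ ^ 2 ≤ 0 := by rw [h2, hxm]; linarith
  have h4 : ‖x - m‖ = 0 := by nlinarith [norm_nonneg (x - m)]
  exact sub_eq_zero.mp (norm_eq_zero.mp h4)

variable {G : Type u}

theorem isPositive_convex {x y : BL2 G} (hx : x.IsPositive) (hy : y.IsPositive) {s t : ℝ}
    (hs : 0 ≤ s) (ht : 0 ≤ t) : ((s : ℂ) • x + (t : ℂ) • y).IsPositive :=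
  (hx.smul_of_nonneg (Complex.zero_le_real.mpr hs)).add
    (hy.smul_of_nonneg (Complex.zero_le_real.mpr ht))

theorem norm_convex_le {x y : BL2 G} {M : ℝ} (hx : ‖x‖ ≤ M) (hy : ‖y‖ ≤ M) {s t : ℝ}
    (hs : 0 ≤ s) (ht : 0 ≤ t) (hst : s + t = 1) : ‖(s : ℂ) • x + (t : ℂ) • y‖ ≤ M := by
  refine (norm_add_le _ _).trans ?_
  rw [norm_smul, norm_smul, Complex.norm_of_nonneg hs, Complex.norm_of_nonneg ht]
  calc _ ≤ s * M + t * M := by gcongr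
    _ = _ := by rw [← add_mul, hst, one_mul]

variable [Group G]

/-- Conjugation by `g` as an operator on `ℓ²(G)`. -/
def conjOp (g : G) : BL2 G := leftRegular G g * rightRegular g

theorem norm_conjOp_apply (g : G) (x : L2 G) : ‖conjOp g x‖ = ‖x‖ := by
  change ‖leftRegular G g (rightRegular g x)‖ = _
  rw [norm_leftRegular_apply, norm_rightRegular_apply]

/-- `conjOp g` as a linear isometry. -/
def conjIsometry (g : G) : L2 G →ₗᵢ[ℂ] L2 G where
  toLinearMap := (conjOp g : L2 G →ₗ[ℂ] L2 G)
  norm_map' := norm_conjOp_apply g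

theorem inner_conjOp (g : G) (x y : L2 G) :
    inner ℂ (conjOp g x) (conjOp g y) = inner ℂ x y :=
  (conjIsometry g).inner_map_map x y

variable (G) in
/-- The space of vectors of `ℓ²(G)` that are fixed by conjugation. -/
def classVectors : Submodule ℂ (L2 G) := ⨅ g : G, LinearMap.ker ((conjOp g - 1 : BL2 G) : L2 G →ₗ[ℂ] L2 G)

theorem mem_classVectors {x : L2 G} : x ∈ classVectors G ↔ ∀ g : G, conjOp g x = x := by
  simp [classVectors, sub_eq_zero]

theorem isClosed_classVectors : IsClosed (classVectors G : Set (L2 G)) := by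
  have : (classVectors G : Set (L2 G)) = ⋂ g : G, {x | conjOp g x = x} := by
    ext x
    simp [mem_classVectors]
  rw [this]
  exact isClosed_iInter fun g => isClosed_eq (conjOp g).continuous continuous_id

instance : CompleteSpace (classVectors G) := isClosed_classVectors.completeSpace_coe

/-- Conjugation preserves inner products and fixes class vectors, so x and its conjugates have the
same inner products with these. -/
theorem starProjection_conjOp (g : G) (x : L2 G) :
    (classVectors G).starProjection (conjOp g x) = (classVectors G).starProjection x := by
  refine Submodule.eq_starProjection_of_mem_of_inner_eq_zero
    (Submodule.starProjection_apply_mem _ x) fun w hw => ?_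
  have h1 := Submodule.starProjection_inner_eq_zero (K := classVectors G) x w hw
  have h2 := inner_conjOp g x w
  rw [mem_classVectors.mp hw g] at h2
  rw [inner_sub_left] at h1 ⊢
  rw [h2, h1]

/-- Conjugation of an element of `N(G)` by a group element. -/
def conjVN (g : G) (a : NG G) : NG G := leftRegularVN G g * a * leftRegularVN G g⁻¹

theorem vec_conjVN (g : G) (a : NG G) : vec (conjVN g a) = conjOp g (vec a) := by
  change leftRegular G g ((a : BL2 G) (leftRegular G g⁻¹ (delta 1))) =
    leftRegular G g (rightRegular g (vec a))
  rw [leftRegular_delta, mul_one, apply_delta, inv_inv]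
  rfl

theorem conjVN_eq_iff (g : G) (a : NG G) :
    conjVN g a = a ↔ leftRegularVN G g * a = a * leftRegularVN G g := by
  constructor
  · intro h
    conv_rhs => rw [← h]
    rw [conjVN, mul_assoc _ (leftRegularVN G g⁻¹), ← map_mul]
    simp
  · intro h
    rw [conjVN, h, mul_assoc, ← map_mul]
    simp

/-- Invariance of the vector means commuting with the group, because δ_e is separating; by the
double commutant this is centrality. -/
theorem vec_mem_classVectors {a : NG G} :
    vec a ∈ classVectors G ↔ a ∈ Subalgebra.center ℂ (NG G) := by
  rw [mem_classVectors]
  constructor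
  · intro h
    refine mem_center_of_comm fun g => ?_
    have := (conjVN_eq_iff g a).mp (vec_injective ((vec_conjVN g a).trans (h g)))
    exact congrArg Subtype.val this
  · intro h g
    rw [← vec_conjVN, (conjVN_eq_iff g a).mpr (center_comm h _)]

theorem norm_conjVN_le (g : G) (a : NG G) : ‖(conjVN g a : BL2 G)‖ ≤ ‖(a : BL2 G)‖ := by
  refine ContinuousLinearMap.opNorm_le_bound _ (norm_nonneg _) fun x => ?_
  change ‖leftRegular G g ((a : BL2 G) (leftRegular G g⁻¹ x))‖ ≤ _
  rw [norm_leftRegular_apply, ← norm_leftRegular_apply g⁻¹ x]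
  exact (a : BL2 G).le_opNorm _

theorem isPositive_conjVN (g : G) {a : NG G} (ha : (a : BL2 G).IsPositive) :
    (conjVN g a : BL2 G).IsPositive := by
  have h := ha.conj_adjoint (leftRegular G g)
  rw [← ContinuousLinearMap.star_eq_adjoint, star_leftRegular] at h
  exact h

/-- The closure of a convex conjugation-invariant subset of `N(G)`, seen in `ℓ²(G)`, contains the
orthogonal projections of its elements to the space of class vectors. -/
theorem starProjection_vec_mem_closure {S : Set (NG G)}
    (hconv : ∀ x ∈ S, ∀ y ∈ S, ∀ s t : ℝ, 0 ≤ s → 0 ≤ t → s + t = 1 →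
      (s : ℂ) • x + (t : ℂ) • y ∈ S)
    (hconj : ∀ g, ∀ x ∈ S, conjVN g x ∈ S) {a : NG G} (ha : a ∈ S) :
    (classVectors G).starProjection (vec a) ∈ closure (vec '' S) := by
  set P := (classVectors G).starProjection with hP
  -- The extra condition on projections is closed, convex and conjugation-invariant. The minimal
  -- vector of `C` is unique, hence fixed by the isometries `conjOp g`, and so it is its own
  -- projection.
  let C : Set (L2 G) := closure (vec '' S) ∩ {x | P x = P (vec a)}
  have hC : IsClosed C :=
    isClosed_closure.inter (isClosed_eq P.continuous continuous_const)
  obtain ⟨m, hm, huniq⟩ := exists_unique_norm_minimal (C := C) ⟨vec a, subset_closure ⟨a, ha, rfl⟩, rfl⟩ hC (by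
    rintro x ⟨hx, hx'⟩ y ⟨hy, hy'⟩ s t hs ht hst
    refine ⟨?_, ?_⟩
    · refine map_mem_closure₂ (f := fun x y : L2 G => (s : ℂ) • x + (t : ℂ) • y) (by fun_prop)
        hx hy ?_
      rintro _ ⟨x, hx, rfl⟩ _ ⟨y, hy, rfl⟩
      exact ⟨_, hconv x hx y hy s t hs ht hst, rfl⟩
    · change P _ = _
      rw [map_add, map_smul, map_smul, hx', hy', ← add_smul, ← Complex.ofReal_add, hst]
      simp)
  have hfix : m ∈ classVectors G := by
    rw [mem_classVectors]
    intro g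
    refine huniq _ ⟨?_, ?_⟩ (norm_conjOp_apply g m)
    · refine map_mem_closure (conjOp g).continuous hm.1 ?_
      rintro _ ⟨x, hx, rfl⟩
      exact ⟨_, hconj g x hx, vec_conjVN g x⟩
    · change P _ = _
      rw [hP, starProjection_conjOp]
      exact hm.2
  have : P m = m := Submodule.starProjection_eq_self_iff.mpr hfix
  rw [← show P m = P (vec a) from hm.2, this]
  exact hm.1

theorem exists_center_vec_eq (a : NG G) :
    ∃ b : ZNG G, ‖((b : NG G) : BL2 G)‖ ≤ ‖(a : BL2 G)‖ ∧
      vec (b : NG G) = (classVectors G).starProjection (vec a) := by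
  have h := starProjection_vec_mem_closure (S := {b : NG G | ‖(b : BL2 G)‖ ≤ ‖(a : BL2 G)‖}) (by
    exact fun x hx y hy s t hs ht hst => norm_convex_le hx hy hs ht hst)
    (fun g x hx => (norm_conjVN_le g x).trans hx) (a := a) (le_refl ‖(a : BL2 G)‖)
  rw [(isClosed_vec_ball _).closure_eq] at h
  obtain ⟨b, hb, hb'⟩ := h
  have hc : b ∈ Subalgebra.center ℂ (NG G) := by
    rw [← vec_mem_classVectors, hb']
    exact Submodule.starProjection_apply_mem _ _
  exact ⟨⟨b, hc⟩, hb, hb'⟩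

theorem center_ext {a b : ZNG G} (h : vec (a : NG G) = vec (b : NG G)) : a = b :=
  Subtype.ext (vec_injective h)

variable (G) in
/-- The conditional expectation of `N(G)` onto its center. -/
def centerExp : NG G →ₗ[ℂ] ZNG G where
  toFun a := (exists_center_vec_eq a).choose
  map_add' a b := center_ext (by
    change _ = vec _ + vec _
    rw [(exists_center_vec_eq _).choose_spec.2, (exists_center_vec_eq _).choose_spec.2,
      (exists_center_vec_eq _).choose_spec.2, vec_add, map_add])
  map_smul' c a := center_ext (by
    change _ = c • vec _
    rw [(exists_center_vec_eq _).choose_spec.2, (exists_center_vec_eq _).choose_spec.2,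
      vec_smul, map_smul])

theorem vec_centerExp (a : NG G) :
    vec (centerExp G a : NG G) = (classVectors G).starProjection (vec a) :=
  (exists_center_vec_eq a).choose_spec.2

theorem norm_centerExp_le (a : NG G) : ‖((centerExp G a : NG G) : BL2 G)‖ ≤ ‖(a : BL2 G)‖ :=
  (exists_center_vec_eq a).choose_spec.1

theorem centerExp_center (c : ZNG G) : centerExp G (c : NG G) = c := center_ext (by
  rw [vec_centerExp]
  exact Submodule.starProjection_eq_self_iff.mpr (vec_mem_classVectors.mpr c.2))

theorem isPositive_centerExp {a : NG G} (ha : (a : BL2 G).IsPositive) :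
    ((centerExp G a : NG G) : BL2 G).IsPositive := by
  have h := starProjection_vec_mem_closure
    (S := {b : NG G | ‖(b : BL2 G)‖ ≤ ‖(a : BL2 G)‖ ∧ (b : BL2 G).IsPositive})
    (fun x hx y hy s t hs ht hst =>
      ⟨norm_convex_le hx.1 hy.1 hs ht hst, isPositive_convex hx.2 hy.2 hs ht⟩)
    (fun g x hx => ⟨(norm_conjVN_le g x).trans hx.1, isPositive_conjVN g hx.2⟩)
    (a := a) ⟨le_rfl, ha⟩
  rw [(isClosed_vec_ball_isPositive _).closure_eq, ← vec_centerExp] at h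
  obtain ⟨b, hb, hb'⟩ := h
  rw [← vec_injective hb']
  exact hb.2

/-- The vector of w* is a class vector, so pairing with it does not see the projection. -/
theorem trG_centerExp_mul (a : NG G) {w : NG G} (hw : w ∈ Subalgebra.center ℂ (NG G)) :
    trG ((centerExp G a : NG G) * w) = trG (a * w) := by
  rw [trG_mul_comm, trG_mul, vec_centerExp, trG_mul_comm a, trG_mul,
    ← Submodule.inner_starProjection_left_eq_right,
    Submodule.starProjection_eq_self_iff.mpr (vec_mem_classVectors.mpr (star_mem_center hw))]

theorem trG_centerExp (a : NG G) : trG (centerExp G a : NG G) = trG a := by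
  simpa using trG_centerExp_mul a (one_mem _)

/-- Testing against w = `star (centerExp G (a - b))` and faithfulness of `trG` kill the difference.
Traciality and linearity over the center follow from this criterion. -/
theorem centerExp_eq_of_trG {a b : NG G}
    (h : ∀ w ∈ Subalgebra.center ℂ (NG G), trG (a * w) = trG (b * w)) :
    centerExp G a = centerExp G b := by
  rw [← sub_eq_zero, ← map_sub]
  have hc := (centerExp G (a - b)).2
  refine Subtype.ext (eq_zero_of_trG_star_mul_self ?_)
  rw [trG_mul_comm, trG_centerExp_mul _ (star_mem_center hc), sub_mul, ← trGₗ_apply, map_sub,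
    trGₗ_apply, trGₗ_apply, h _ (star_mem_center hc), sub_self]

theorem centerExp_mul_comm (a b : NG G) : centerExp G (a * b) = centerExp G (b * a) :=
  centerExp_eq_of_trG fun w hw => by
    rw [mul_assoc, trG_mul_comm a, mul_assoc, ← center_comm hw a, ← mul_assoc]

theorem centerExp_center_mul (c : ZNG G) (a : NG G) :
    centerExp G ((c : NG G) * a) = c * centerExp G a := by
  rw [← centerExp_center (c * centerExp G a)]
  refine centerExp_eq_of_trG fun w hw => ?_
  change _ = trG ((c : NG G) * (centerExp G a : NG G) * w)
  rw [← center_comm c.2 a, ← center_comm c.2, mul_assoc, mul_assoc,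
    trG_centerExp_mul _ (mul_mem c.2 hw)]

theorem isCenterValuedTrace_centerExp : IsCenterValuedTrace (centerExp G) where
  tracial := centerExp_mul_comm
  map_center := centerExp_center
  positive _ := isPositive_centerExp

/-- Existence, witnessed by `centerExp`, rules out the default value 0 of `trU`. -/
theorem isCenterValuedTrace_trU : IsCenterValuedTrace (trU G) := by
  have h : ∃ τ : NG G →ₗ[ℂ] ZNG G, IsCenterValuedTrace τ := ⟨_, isCenterValuedTrace_centerExp⟩
  rw [trU, dif_pos h]
  exact h.choose_spec

end ConditionalExpectation

/-! ### Comparison of projections via extreme points -/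

section Comparison

section CStar

variable {A : Type u} [CStarAlgebra A] [PartialOrder A] [StarOrderedRing A]

theorem norm_le_one_iff_star_mul_self_le {x : A} : ‖x‖ ≤ 1 ↔ star x * x ≤ 1 := by
  rw [← CStarAlgebra.norm_le_one_iff_of_nonneg _ (star_mul_self_nonneg x),
    CStarRing.norm_star_mul_self]
  constructor
  · intro h
    nlinarith [norm_nonneg x]
  · intro h
    nlinarith [norm_nonneg x]

/-- With a = v*v, the defect 1 − w*w of w = ½v(3 − a) equals ¼(1 − a)(4 − a)(1 − a) ≥ 0. This w is v
+ ½v(1 − v*v); its partner v − ½v(1 − v*v) = ½v(1 + v*v) is treated in the next lemma. -/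
theorem norm_half_mul_three_sub_le {v : A} (hv : ‖v‖ ≤ 1) :
    ‖(2⁻¹ : ℂ) • (v * (3 - star v * v))‖ ≤ 1 := by
  have h1 : star v * v ≤ 1 := norm_le_one_iff_star_mul_self_le.mp hv
  rw [norm_le_one_iff_star_mul_self_le]
  set a := star v * v with ha
  have hs : star a = a := by simp [ha]
  have h4 : (0 : A) ≤ 4 - a := by
    have : (0 : A) ≤ 3 := by
      rw [show (3 : A) = 1 + 1 + 1 by norm_num]
      exact add_nonneg (add_nonneg zero_le_one zero_le_one) zero_le_one
    have h := add_nonneg this (sub_nonneg.mpr h1)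
    convert h using 1
    rw [← add_sub_assoc]
    norm_num
  have h5 := star_left_conjugate_nonneg h4 (1 - a)
  have h6 : (0 : A) ≤ (4⁻¹ : ℂ) • (star (1 - a) * (4 - a) * (1 - a)) := by
    have h7 : (0 : A) ≤ (4⁻¹ : ℝ) • (star (1 - a) * (4 - a) * (1 - a)) :=
      smul_nonneg (by norm_num) h5
    convert h7 using 1
    rw [← Complex.coe_smul]
    norm_num
  rw [← sub_nonneg]
  convert h6 using 1
  have e1 : star ((2⁻¹ : ℂ) • (v * (3 - a))) * ((2⁻¹ : ℂ) • (v * (3 - a))) =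
      (4⁻¹ : ℂ) • ((3 - a) * a * (3 - a)) := by
    rw [star_smul, smul_mul_smul_comm, star_mul, star_sub, hs, ha]
    have h3 : star (3 : A) = 3 := star_ofNat 3
    rw [h3]
    congr 1
    · rw [star_inv₀, star_ofNat]; norm_num
    · noncomm_ring
  rw [e1, star_sub, star_one, hs]
  have e2 : (1 : A) = (4⁻¹ : ℂ) • (4 : A) := by
    rw [show (4 : A) = (4 : ℂ) • 1 by rw [Algebra.smul_def, mul_one, map_ofNat], smul_smul]
    norm_num
  rw [show (1 : A) - (4⁻¹ : ℂ) • ((3 - a) * a * (3 - a)) =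
    (4⁻¹ : ℂ) • ((4 : A) - (3 - a) * a * (3 - a)) by rw [smul_sub, ← e2]]
  congr 1
  noncomm_ring
  simp only [Int.reduceNeg, zsmul_one, Int.cast_ofNat]
  abel

theorem norm_half_mul_one_add_le {A : Type u} [CStarAlgebra A] {v : A} (hv : ‖v‖ ≤ 1) :
    ‖(2⁻¹ : ℂ) • (v * (1 + star v * v))‖ ≤ 1 := by
  nontriviality A
  rw [norm_smul]
  have h1 : ‖star v * v‖ ≤ 1 := by
    rw [CStarRing.norm_star_mul_self]
    nlinarith [norm_nonneg v]
  have h2 : ‖v * (1 + star v * v)‖ ≤ 1 * (1 + 1) := by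
    refine (norm_mul_le _ _).trans ?_
    gcongr
    refine (norm_add_le _ _).trans ?_
    rw [norm_one]
    gcongr
  norm_num at h2 ⊢
  linarith

/-- Adding to a partial isometry a contraction between the complements of its source and range
gives a contraction. -/
theorem norm_add_le_one_of_orthogonal {v y : A} (h1 : star v * y = 0)
    (h2 : IsStarProjection (1 - star v * v)) (h3 : y * (1 - star v * v) = y) (hy : ‖y‖ ≤ 1) :
    ‖v + y‖ ≤ 1 := by
  rw [norm_le_one_iff_star_mul_self_le] at hy ⊢
  have h4 : star y * v = 0 := by simpa using congrArg star h1
  have h5 := star_left_conjugate_le_conjugate hy (1 - star v * v)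
  rw [mul_one, h2.isSelfAdjoint.star_eq, h2.isIdempotentElem, mul_assoc, mul_assoc, h3,
    ← mul_assoc] at h5
  have h6 : (1 - star v * v) * star y = star y := by
    rw [← h2.isSelfAdjoint.star_eq, ← star_mul, h3]
  rw [h6] at h5
  rw [star_add, add_mul, mul_add, mul_add, h1, h4, add_zero, zero_add]
  calc _ ≤ star v * v + (1 - star v * v) := by gcongr
    _ = 1 := by abel

/-- An extreme point of the contractions from `e` to `f` in a star subalgebra is a maximal partial
isometry. -/
theorem maximal_of_extreme {N : StarSubalgebra ℂ A} {e f v : A} (he : IsStarProjection e)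
    (hf : IsStarProjection f) (heN : e ∈ N) (hfN : f ∈ N) (hvN : v ∈ N) (hv : ‖v‖ ≤ 1)
    (hfve : f * v * e = v)
    (hext : ∀ w ∈ N, ‖v + w‖ ≤ 1 → ‖v - w‖ ≤ 1 → f * w * e = w → w = 0) :
    f * v = v ∧ v * e = v ∧ v * star v * v = v ∧
      ∀ c ∈ N, (f - v * star v) * c * (e - star v * v) = 0 := by
  have hfv : f * v = v := by
    conv_rhs => rw [← hfve]
    conv_lhs => rw [← hfve]
    rw [← mul_assoc, ← mul_assoc, hf.isIdempotentElem]
  have hve : v * e = v := by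
    conv_rhs => rw [← hfve]
    conv_lhs => rw [← hfve]
    rw [mul_assoc, he.isIdempotentElem]
  have hev : e * star v = star v := by simpa [he.isSelfAdjoint.star_eq] using congrArg star hve
  have hvf : star v * f = star v := by simpa [hf.isSelfAdjoint.star_eq] using congrArg star hfv
  have hiso : v * star v * v = v := by
    -- Both v ± ½v(1 − v*v) are contractions, so extremality forces v = vv*v.
    have h := hext ((2⁻¹ : ℂ) • (v * (1 - star v * v))) ?_ ?_ ?_ ?_
    · rw [smul_eq_zero_iff_right (by norm_num), mul_sub, mul_one, sub_eq_zero, ← mul_assoc] at h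
      exact h.symm
    · exact N.smul_mem (mul_mem hvN (sub_mem (one_mem N) (mul_mem (star_mem hvN) hvN))) _
    · have h2 := norm_half_mul_three_sub_le hv
      convert h2 using 2
      have : v + (2⁻¹ : ℂ) • (v * (1 - star v * v)) = (2⁻¹ : ℂ) • (v * (3 - star v * v)) := by
        have h3 : v = (2⁻¹ : ℂ) • (v * 2) := by
          rw [mul_two, ← two_smul ℂ v, smul_smul]; norm_num
        nth_rewrite 1 [h3]
        rw [← smul_add, ← mul_add, ← add_sub_assoc]
        norm_num
      exact this
    · have h2 := norm_half_mul_one_add_le hv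
      convert h2 using 2
      have : v - (2⁻¹ : ℂ) • (v * (1 - star v * v)) = (2⁻¹ : ℂ) • (v * (1 + star v * v)) := by
        have h3 : v = (2⁻¹ : ℂ) • (v * 2) := by
          rw [mul_two, ← two_smul ℂ v, smul_smul]; norm_num
        nth_rewrite 1 [h3]
        rw [← smul_sub, ← mul_sub]
        congr 2
        rw [sub_sub_eq_add_sub, add_sub_right_comm]
        norm_num
      exact this
    · rw [mul_smul_comm, smul_mul_assoc, ← mul_assoc f, hfv, mul_assoc, sub_mul, one_mul, mul_sub,
        hve, mul_assoc (star v), hve, mul_sub, mul_one]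
  refine ⟨hfv, hve, hiso, fun c hc => ?_⟩
  have hiso' : star v * v * star v = star v := by
    simpa [mul_assoc] using congrArg star hiso
  set f' := f - v * star v with hf'
  set e' := e - star v * v with he'
  set y := f' * c * e' with hy
  have hvf' : star v * f' = 0 := by rw [hf', mul_sub, hvf, ← mul_assoc, hiso', sub_self]
  have hff' : f * f' = f' := by rw [hf', mul_sub, hf.isIdempotentElem, ← mul_assoc, hfv]
  have hve' : v * e' = 0 := by rw [he', mul_sub, hve, ← mul_assoc, hiso, sub_self]
  have hee' : e' * e = e' := by rw [he', sub_mul, he.isIdempotentElem, mul_assoc, hve]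
  have he'v : e' * (star v * v) = 0 := by
    rw [he', sub_mul, ← mul_assoc, hev, ← mul_assoc, hiso', sub_self]
  have hp : IsStarProjection (1 - star v * v) :=
    IsStarProjection.one_sub ⟨by rw [IsIdempotentElem, ← mul_assoc, hiso'], by
      simp [IsSelfAdjoint]⟩
  -- Here v*y = 0 and y lives on the complement of v*v, so a small multiple of y may be added to or
  -- subtracted from v without leaving the unit ball.
  have key : ∀ s : ℂ, ‖s • y‖ ≤ 1 → ‖v + s • y‖ ≤ 1 := by
    intro s hs
    refine norm_add_le_one_of_orthogonal ?_ hp ?_ hs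
    · have : star v * (s • y) = 0 := by
        rw [mul_smul_comm, hy, ← mul_assoc, ← mul_assoc, hvf', zero_mul, zero_mul, smul_zero]
      exact this
    · have : (s • y) * (1 - star v * v) = s • y := by
        rw [smul_mul_assoc, mul_sub, mul_one, hy, mul_assoc (f' * c), he'v, mul_zero, sub_zero]
      exact this
  set r : ℝ := (‖y‖ + 1)⁻¹ with hr
  have hr0 : 0 < r := by positivity
  have hnorm : ∀ s : ℂ, ‖s‖ = r → ‖s • y‖ ≤ 1 := by
    intro s hs
    rw [norm_smul, hs, hr, inv_mul_le_iff₀ (by positivity)]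
    linarith
  have h := hext ((r : ℂ) • y) (N.smul_mem (mul_mem (mul_mem (sub_mem hfN (mul_mem hvN (star_mem hvN))) hc)
    (sub_mem heN (mul_mem (star_mem hvN) hvN))) _) (key _ (hnorm _ (by simp [abs_of_pos hr0]))) (by
      have h2 := key (-(r : ℂ)) (hnorm _ (by simp [abs_of_pos hr0]))
      rw [neg_smul, ← sub_eq_add_neg] at h2
      exact h2) (by
      rw [mul_smul_comm, smul_mul_assoc, hy, ← mul_assoc, ← mul_assoc, hff', mul_assoc _ e', hee'])
  exact (smul_eq_zero_iff_right (by exact_mod_cast hr0.ne')).mp h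

end CStar

/-- Krein–Milman in the weak operator topology, with extremality rephrased for symmetric
perturbations v ± w. -/
theorem exists_extreme_wot {H : Type u} [NormedAddCommGroup H] [InnerProductSpace ℂ H]
    [CompleteSpace H] {K : Set (H →WOT[ℂ] H)} (hK : IsCompact K) (hne : K.Nonempty) :
    ∃ v ∈ K, ∀ w, v + w ∈ K → v - w ∈ K → w = 0 := by
  obtain ⟨v, hv⟩ := hK.extremePoints_nonempty hne
  refine ⟨v, hv.1, fun w h1 h2 => ?_⟩
  have h := (mem_extremePoints.mp hv).2 _ h1 _ h2
    ⟨1 / 2, 1 / 2, by norm_num, by norm_num, by norm_num, by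
      rw [← smul_add, add_add_sub_cancel, ← two_smul ℝ v, smul_smul]; norm_num⟩
  simpa using h.1

variable {G : Type u} [Group G]

theorem exists_extreme_groupVN (e f : NG G) :
    ∃ v : NG G, ‖(v : BL2 G)‖ ≤ 1 ∧ f * v * e = v ∧
      ∀ w : NG G, ‖((v + w : NG G) : BL2 G)‖ ≤ 1 → ‖((v - w : NG G) : BL2 G)‖ ≤ 1 →
        f * w * e = w → w = 0 := by
  let K : Set (L2 G →WOT[ℂ] L2 G) :=
    {A | ‖A.toCLM‖ ≤ 1 ∧ A.toCLM ∈ (groupVN G).toStarSubalgebra} ∩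
      {A | (f : BL2 G) * A.toCLM * (e : BL2 G) = 1 * A.toCLM * 1}
  have hK : IsCompact K :=
    (isCompact_wot_groupVN_ball 1).inter_right (isClosed_wot_mul_eq _ _ _ _)
  obtain ⟨A, hA, hext⟩ := exists_extreme_wot hK
    ⟨0, ⟨by simp, zero_mem (groupVN G).toStarSubalgebra⟩, by simp⟩
  have hA3 : (f : BL2 G) * A.toCLM * (e : BL2 G) = A.toCLM := by simpa using hA.2
  refine ⟨⟨A.toCLM, hA.1.2⟩, hA.1.1, Subtype.ext hA3, fun w h1 h2 h3 => ?_⟩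
  have h3' : (f : BL2 G) * (w : BL2 G) * (e : BL2 G) = w := congrArg Subtype.val h3
  have h0 := hext (ContinuousLinearMapWOT.ofCLM (w : BL2 G)) ⟨⟨h1, ?_⟩, ?_⟩ ⟨⟨h2, ?_⟩, ?_⟩
  · exact Subtype.ext (congrArg ContinuousLinearMapWOT.toCLM h0)
  · exact add_mem hA.1.2 w.2
  · change (f : BL2 G) * (A.toCLM + (w : BL2 G)) * (e : BL2 G) = 1 * (A.toCLM + (w : BL2 G)) * 1
    rw [mul_add, add_mul, hA3, h3', one_mul, mul_one]
  · exact sub_mem hA.1.2 w.2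
  · change (f : BL2 G) * (A.toCLM - (w : BL2 G)) * (e : BL2 G) = 1 * (A.toCLM - (w : BL2 G)) * 1
    rw [mul_sub, sub_mul, hA3, h3', one_mul, mul_one]

/-- For projections `e` and `f` there is a maximal partial isometry from `e` to `f`. -/
theorem exists_maximal_partial_isometry {e f : NG G} (he : IsStarProjection e)
    (hf : IsStarProjection f) :
    ∃ v : NG G, f * v = v ∧ v * e = v ∧ v * star v * v = v ∧
      ∀ c, (f - v * star v) * c * (e - star v * v) = 0 := by
  obtain ⟨v, hv, hfve, hext⟩ := exists_extreme_groupVN e f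
  obtain ⟨h1, h2, h3, h4⟩ := maximal_of_extreme (N := (groupVN G).toStarSubalgebra)
    (e := (e : BL2 G)) (f := (f : BL2 G)) (v := (v : BL2 G))
    ⟨congrArg Subtype.val he.isIdempotentElem, congrArg Subtype.val he.isSelfAdjoint⟩
    ⟨congrArg Subtype.val hf.isIdempotentElem, congrArg Subtype.val hf.isSelfAdjoint⟩
    e.2 f.2 v.2 hv (congrArg Subtype.val hfve)
    (fun w hw h1 h2 h3 => congrArg Subtype.val (hext ⟨w, hw⟩ h1 h2 (Subtype.ext h3)))
  exact ⟨v, Subtype.ext h1, Subtype.ext h2, Subtype.ext h3, fun c => Subtype.ext (h4 c c.2)⟩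

theorem isPositive_of_isStarProjection {p : NG G} (hp : IsStarProjection p) :
    (p : BL2 G).IsPositive :=
  ContinuousLinearMap.IsPositive.of_isStarProjection
    ⟨congrArg Subtype.val hp.isIdempotentElem, congrArg Subtype.val hp.isSelfAdjoint⟩

theorem isPositive_star_mul_mul {a : NG G} (ha : (a : BL2 G).IsPositive) (x : NG G) :
    ((star x * a * x : NG G) : BL2 G).IsPositive := by
  have h := ha.adjoint_conj (x : BL2 G)
  rw [← ContinuousLinearMap.star_eq_adjoint] at h
  exact h

theorem star_eq_of_isPositive {a : NG G} (ha : (a : BL2 G).IsPositive) : star a = a :=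
  Subtype.ext ha.isSelfAdjoint

/-- Elements that are separated by all of `N(G)` have orthogonal central expectations. -/
theorem mul_centerExp_eq_zero {a b : NG G} (h : ∀ c, a * c * b = 0) :
    a * (centerExp G b : NG G) = 0 := by
  -- The elements x with acx = 0 for all c form a convex conjugation-invariant set, and the vectors
  -- of its closure are killed by a.
  have h1 := starProjection_vec_mem_closure (S := {b : NG G | ∀ c, a * c * b = 0})
    (fun x hx y hy s t _ _ _ c => by
      rw [mul_add, mul_smul_comm, mul_smul_comm, hx c, hy c, smul_zero, smul_zero, add_zero])
    (fun g x hx c => by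
      rw [conjVN, ← mul_assoc, ← mul_assoc, mul_assoc a, hx, zero_mul])
    (a := b) h
  rw [← vec_centerExp] at h1
  have h2 : closure (vec '' {b : NG G | ∀ c, a * c * b = 0}) ⊆ {x | (a : BL2 G) x = 0} := by
    refine closure_minimal ?_ (isClosed_eq (a : BL2 G).continuous continuous_const)
    rintro _ ⟨x, hx, rfl⟩
    have := hx 1
    rw [mul_one] at this
    change vec (a * x) = 0
    rw [this]
    rfl
  exact vec_injective (h2 h1)

/-- Comparison of projections by their center-valued traces. -/
theorem exists_partial_isometry_of_centerExp_le {e f : NG G} (he : IsStarProjection e)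
    (hf : IsStarProjection f)
    (hle : ((centerExp G f - centerExp G e : NG G) : BL2 G).IsPositive) :
    ∃ v : NG G, star v * v = e ∧ IsStarProjection (f - v * star v) := by
  obtain ⟨v, hfv, hve, hiso, hsep⟩ := exists_maximal_partial_isometry he hf
  have hiso' : star v * v * star v = star v := by
    simpa [mul_assoc] using congrArg star hiso
  have h1 : IsStarProjection (star v * v) :=
    ⟨by rw [IsIdempotentElem, ← mul_assoc, hiso'], by simp [IsSelfAdjoint]⟩
  have h2 : IsStarProjection (v * star v) :=
    ⟨by rw [IsIdempotentElem, ← mul_assoc, hiso], by simp [IsSelfAdjoint]⟩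
  have h3 : IsStarProjection (f - v * star v) :=
    h2.sub_of_mul_eq_right hf (by rw [← mul_assoc, hfv])
  have h4 : IsStarProjection (e - star v * v) :=
    h1.sub_of_mul_eq_left he (by rw [mul_assoc, hve])
  refine ⟨v, ?_, h3⟩
  set f' := f - v * star v with hf'
  set e' := e - star v * v with he'
  have h5 : centerExp G e' * centerExp G f' = 0 := by
    rw [← centerExp_center_mul, ← center_comm (centerExp G e').2, mul_centerExp_eq_zero hsep,
      map_zero]
  have h6 : centerExp G f' - centerExp G e' = centerExp G f - centerExp G e := by
    rw [hf', he', map_sub, map_sub, centerExp_mul_comm v]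
    abel
  set d : ZNG G := centerExp G f - centerExp G e with hd
  have hstar : star (centerExp G e' : NG G) = centerExp G e' :=
    star_eq_of_isPositive (isPositive_centerExp (isPositive_of_isStarProjection h4))
  -- Since E(e')E(f') = 0 and E(f') − E(e') = d ≥ 0, one gets E(e')² = −E(e')d. The trace of the
  -- left side is nonnegative, that of the right side nonpositive; faithfulness gives E(e') = 0 and
  -- then e' = 0.
  have h7 : (centerExp G e' : NG G) * (centerExp G e' : NG G) =
      -((centerExp G e' : NG G) * (d : NG G)) := by
    have h5' : (centerExp G e' : NG G) * (centerExp G f' : NG G) = 0 := congrArg Subtype.val h5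
    have h6' : (centerExp G f' : NG G) - (centerExp G e' : NG G) = d := congrArg Subtype.val h6
    rw [← h6', mul_sub, h5', zero_sub, neg_neg]
  have h8 : 0 ≤ trG ((centerExp G e' : NG G) * (d : NG G)) := by
    rw [trG_centerExp_mul _ d.2]
    have h9 := trG_nonneg (isPositive_star_mul_mul hle e')
    rwa [trG_mul_comm, h4.isSelfAdjoint.star_eq, ← mul_assoc, h4.isIdempotentElem] at h9
  have h10 : trG (star (centerExp G e' : NG G) * (centerExp G e' : NG G)) = 0 := by
    refine le_antisymm ?_ ?_
    · rw [hstar, h7, ← trGₗ_apply, map_neg, trGₗ_apply]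
      exact neg_nonpos.mpr h8
    · rw [trG_star_mul_self]
      exact_mod_cast sq_nonneg ‖vec (centerExp G e' : NG G)‖
  have h11 := eq_zero_of_trG_star_mul_self h10
  have h12 : trG (star e' * e') = 0 := by
    rw [h4.isSelfAdjoint.star_eq, h4.isIdempotentElem, ← trG_centerExp, h11, ← trGₗ_apply, map_zero]
  exact (sub_eq_zero.mp (eq_zero_of_trG_star_mul_self h12)).symm

end Comparison

/-! ### Spectral projections -/

section SpectralProjection

/-- The spectral projection of a self-adjoint operator `y` for the half-line above `t`. -/
theorem exists_spectral_projection_operator {H : Type u} [NormedAddCommGroup H]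
    [InnerProductSpace ℂ H] [CompleteSpace H] {y : H →L[ℂ] H} (hy : IsSelfAdjoint y) (t : ℝ) :
    ∃ p : H →L[ℂ] H, IsStarProjection p ∧ (p * (y - (t : ℂ) • 1)).IsPositive ∧
      ((1 - p) * ((t : ℂ) • 1 - y)).IsPositive ∧ ∀ S, S * y = y * S → S * p = p * S := by
  set z : H →L[ℂ] H := y - (t : ℂ) • 1 with hz
  have hzs : IsSelfAdjoint z := hy.sub (by simp [IsSelfAdjoint])
  set c := z⁺ with hc
  set d := z⁻ with hd
  have hcd : c * d = 0 := CFC.posPart_mul_negPart z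
  have hzcd : c - d = z := CFC.posPart_sub_negPart z
  have hc0 : 0 ≤ c := CFC.posPart_nonneg z
  have hd0 : 0 ≤ d := CFC.negPart_nonneg z
  have hcs : star c = c := (IsSelfAdjoint.of_nonneg hc0).star_eq
  have hds : star d = d := (IsSelfAdjoint.of_nonneg hd0).star_eq
  -- The projection sought is that onto the complement of the kernel of c = (y − t)⁺; this kernel
  -- contains the range of (y − t)⁻.
  set V : Submodule ℂ H := LinearMap.ker (c : H →ₗ[ℂ] H) with hV
  have hVc : IsClosed (V : Set H) := ContinuousLinearMap.isClosed_ker c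
  have : CompleteSpace V := hVc.completeSpace_coe
  have hmem : ∀ {x}, x ∈ V ↔ c x = 0 := Iff.rfl
  set q : H →L[ℂ] H := V.starProjection with hq
  have hqp : IsStarProjection q := isStarProjection_starProjection
  have hqs : star q = q := hqp.isSelfAdjoint.star_eq
  have hcq : c * q = 0 := by
    ext1 x
    exact hmem.mp (Submodule.starProjection_apply_mem V x)
  have hqc : q * c = 0 := by simpa [hqs, hcs] using congrArg star hcq
  have hqd : q * d = d := by
    ext1 x
    refine Submodule.starProjection_eq_self_iff.mpr (hmem.mpr ?_)
    exact congrArg (fun T : H →L[ℂ] H => T x) hcd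
  have hpz : (1 - q) * z = c := by rw [← hzcd, sub_mul, one_mul, mul_sub q, hqc, hqd]; simp
  have hqz : q * z = -d := by rw [← hzcd, mul_sub, hqc, hqd, zero_sub]
  refine ⟨1 - q, hqp.one_sub, ?_, ?_, ?_⟩
  · rw [hpz]
    exact (ContinuousLinearMap.nonneg_iff_isPositive _).mp hc0
  · rw [show (t : ℂ) • (1 : H →L[ℂ] H) - y = -z by rw [hz, neg_sub], sub_sub_cancel, mul_neg, hqz,
      neg_neg]
    exact (ContinuousLinearMap.nonneg_iff_isPositive _).mp hd0
  · intro S hS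
    -- What commutes with y commutes with c by functional calculus and preserves ker c. Using this
    -- for S and S* gives commutation with the projection.
    have hcomm : ∀ T : H →L[ℂ] H, T * y = y * T → ∀ x ∈ V, T x ∈ V := by
      intro T hT x hx
      have h1 : Commute z T := by
        change z * T = T * z
        rw [hz, sub_mul, mul_sub, hT]
        simp
      have h2 : c * T = T * c := h1.cfcₙ_real _
      rw [hmem] at hx ⊢
      change (c * T) x = 0
      rw [h2]
      change T (c x) = 0
      rw [hx, map_zero]
    have hS' : star S * y = y * star S := by
      simpa [hy.star_eq] using (congrArg star hS).symm
    have h3 : q * S = S * q := by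
      ext1 x
      refine Submodule.eq_starProjection_of_mem_of_inner_eq_zero (K := V)
        (hcomm S hS _ (Submodule.starProjection_apply_mem V x)) fun w hw => ?_
      change inner ℂ (S x - S (q x)) w = 0
      rw [← map_sub, ← ContinuousLinearMap.adjoint_inner_right]
      exact Submodule.starProjection_inner_eq_zero (K := V) x _ (hcomm _ hS' w hw)
    rw [mul_sub, sub_mul, h3, mul_one, one_mul]

variable {G : Type u} [Group G]

theorem exists_spectral_projection {y : NG G} (hy : IsSelfAdjoint y) (t : ℝ) :
    ∃ p : NG G, IsStarProjection p ∧ ((p * (y - (t : ℂ) • 1) : NG G) : BL2 G).IsPositive ∧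
      (((1 - p) * ((t : ℂ) • 1 - y) : NG G) : BL2 G).IsPositive ∧ p * y = y * p ∧
      (y ∈ Subalgebra.center ℂ (NG G) → p ∈ Subalgebra.center ℂ (NG G)) := by
  obtain ⟨p, hp, h1, h2, h3⟩ :=
    exists_spectral_projection_operator (y := (y : BL2 G)) (congrArg Subtype.val hy) t
  have hp' : p ∈ (groupVN G).toStarSubalgebra := by
    rw [mem_groupVN]
    exact fun T hT => h3 T (mem_groupVN.mp y.2 T hT)
  refine ⟨⟨p, hp'⟩, ⟨Subtype.ext hp.isIdempotentElem, Subtype.ext hp.isSelfAdjoint⟩, h1, h2,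
    Subtype.ext (h3 _ rfl).symm, fun hc => ?_⟩
  rw [Subalgebra.mem_center_iff]
  exact fun b => Subtype.ext (h3 _ (congrArg Subtype.val (center_comm hc b)))

end SpectralProjection

/-! ### Uniqueness of tracial extensions from the center -/

section Uniqueness

variable {G : Type u} [Group G]

/-- Positive tracial functionals on `N(G)` that agree with the canonical trace on the center. -/
structure ExtendsCentralTrace (φ : NG G →ₗ[ℂ] ℂ) : Prop where
  tracial : ∀ a b, φ (a * b) = φ (b * a)
  center : ∀ c ∈ Subalgebra.center ℂ (NG G), φ c = trG c
  nonneg : ∀ a : NG G, (a : BL2 G).IsPositive → 0 ≤ φ a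

variable {φ : NG G →ₗ[ℂ] ℂ}

theorem ExtendsCentralTrace.re_nonneg (hφ : ExtendsCentralTrace φ) (a : NG G)
    (ha : (a : BL2 G).IsPositive) : 0 ≤ (φ a).re :=
  (Complex.nonneg_iff.mp (hφ.nonneg a ha)).1

theorem ExtendsCentralTrace.map_one (hφ : ExtendsCentralTrace φ) : φ 1 = 1 := by
  rw [hφ.center 1 (one_mem _), trG]
  change inner ℂ (delta (1 : G)) (delta (1 : G)) = 1
  rw [inner_delta, delta_apply_self]

theorem ExtendsCentralTrace.trG_self : ExtendsCentralTrace (trGₗ G) where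
  tracial := trG_mul_comm
  center _ _ := rfl
  nonneg _ ha := trG_nonneg ha

theorem ExtendsCentralTrace.mono (hφ : ExtendsCentralTrace φ) {a b : NG G}
    (h : ((b - a : NG G) : BL2 G).IsPositive) : (φ a).re ≤ (φ b).re := by
  have := hφ.re_nonneg _ h
  rw [map_sub, Complex.sub_re] at this
  linarith

/-- A projection `p` with small center-valued trace has many disjoint copies below the identity. -/
theorem ExtendsCentralTrace.exists_complement (hφ : ExtendsCentralTrace φ) {p : NG G}
    (hp : IsStarProjection p) (n : ℕ)
    (h : ((1 - (n : ℂ) • (centerExp G p : NG G) : NG G) : BL2 G).IsPositive) :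
    ∃ f : NG G, IsStarProjection f ∧
      (centerExp G f : NG G) = 1 - (n : ℂ) • (centerExp G p : NG G) ∧
      φ f = 1 - (n : ℂ) * φ p := by
  induction n with
  | zero =>
    refine ⟨1, .one _, ?_, by simp [hφ.map_one]⟩
    rw [show (1 : NG G) = ((1 : ZNG G) : NG G) from rfl, centerExp_center]
    simp
  | succ n ih =>
    have hpos := isPositive_centerExp (isPositive_of_isStarProjection hp)
    have hadd : (1 - (n : ℂ) • (centerExp G p : NG G) : NG G) =
        (1 - ((n + 1 : ℕ) : ℂ) • (centerExp G p : NG G)) + centerExp G p := by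
      push_cast
      rw [add_smul, one_smul]
      abel
    obtain ⟨f, hf, hEf, hφf⟩ := ih (by rw [hadd]; exact h.add hpos)
    -- The hypothesis for n + 1 says exactly that E(p) ≤ E(f), so one more copy of p can be removed
    -- from f.
    obtain ⟨v, hv, hfv⟩ := exists_partial_isometry_of_centerExp_le hp hf (by
      rw [hEf, hadd, add_sub_cancel_right]
      exact h)
    refine ⟨_, hfv, ?_, ?_⟩
    · rw [map_sub, centerExp_mul_comm v, hv]
      change (centerExp G f : NG G) - (centerExp G p : NG G) = _
      rw [hEf, hadd, add_sub_cancel_right]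
    · rw [map_sub, hφ.tracial v, hv, hφf]
      push_cast
      ring

/-- When E(p) ≤ 1/n, n copies of p fit disjointly under 1; positivity of φ on the remainder gives
the bound. -/
theorem ExtendsCentralTrace.nat_mul_le_one (hφ : ExtendsCentralTrace φ) {p : NG G}
    (hp : IsStarProjection p) (n : ℕ)
    (h : ((1 - (n : ℂ) • (centerExp G p : NG G) : NG G) : BL2 G).IsPositive) :
    n * (φ p).re ≤ 1 := by
  obtain ⟨f, hf, -, hφf⟩ := hφ.exists_complement hp n h
  have h1 := hφ.re_nonneg f (isPositive_of_isStarProjection hf)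
  rw [hφf] at h1
  have h2 : (1 - (n : ℂ) * φ p).re = 1 - n * (φ p).re := by simp
  rw [h2] at h1
  linarith

theorem isPositive_smul {a : NG G} (ha : (a : BL2 G).IsPositive) {r : ℝ} (hr : 0 ≤ r) :
    (((r : ℂ) • a : NG G) : BL2 G).IsPositive :=
  ha.smul_of_nonneg (Complex.zero_le_real.mpr hr)

theorem isPositive_projection_mul {a p : NG G} (hp : IsStarProjection p)
    (ha : (a : BL2 G).IsPositive) (hpa : p * a = a * p) :
    ((p * a : NG G) : BL2 G).IsPositive := by
  have h := isPositive_star_mul_mul ha p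
  rwa [hp.isSelfAdjoint.star_eq, mul_assoc, ← hpa, ← mul_assoc, hp.isIdempotentElem] at h

theorem re_smul_map (φ : NG G →ₗ[ℂ] ℂ) (r : ℝ) (a : NG G) :
    (φ ((r : ℂ) • a)).re = r * (φ a).re := by
  simp

/-- The functional is controlled by the canonical trace on projections. -/
theorem ExtendsCentralTrace.projection_le (hφ : ExtendsCentralTrace φ) {p : NG G}
    (hp : IsStarProjection p) {n : ℕ} (hn : 0 < n) :
    (φ p).re ≤ n * (trG p).re + 1 / n := by
  have hn' : (0 : ℝ) < n := by exact_mod_cast hn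
  set b : NG G := (centerExp G p : NG G) with hb
  have hbpos : (b : BL2 G).IsPositive := isPositive_centerExp (isPositive_of_isStarProjection hp)
  -- The central projection z cuts E(p) at height 1/n. Above it, φ(zp) ≤ φ(z) = tr(z) ≤ n·tr(p) by
  -- Chebyshev; below it, E((1 − z)p) = (1 − z)E(p) ≤ 1/n and `nat_mul_le_one` applies.
  obtain ⟨z, hz, h1, h2, -, hzc⟩ :=
    exists_spectral_projection (star_eq_of_isPositive hbpos) (1 / n : ℝ)
  replace hzc := hzc (centerExp G p).2
  have hzp : p * z = z * p := center_comm hzc p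
  have hzb : b * z = z * b := center_comm hzc b
  have h3 : (φ (z * p)).re ≤ (trG z).re := by
    rw [← hφ.center z hzc]
    refine hφ.mono ?_
    have := isPositive_projection_mul hz (isPositive_of_isStarProjection hp.one_sub)
      (center_comm hzc _).symm
    rwa [mul_sub, mul_one] at this
  have h4 : (trG z).re ≤ n * (trG p).re := by
    have h5 := (ExtendsCentralTrace.trG_self (G := G)).re_nonneg _ h1
    have h6 := (ExtendsCentralTrace.trG_self (G := G)).re_nonneg _
      (isPositive_projection_mul hz.one_sub hbpos (by rw [sub_mul, mul_sub, hzb]; simp))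
    rw [sub_mul, one_mul, map_sub, Complex.sub_re, trGₗ_apply b, hb, trG_centerExp] at h6
    rw [mul_sub, map_sub, Complex.sub_re, mul_smul_comm, mul_one, re_smul_map, trGₗ_apply z] at h5
    have h7 : 1 / n * (trG z).re ≤ (trG p).re := by linarith
    rw [one_div, inv_mul_le_iff₀ hn'] at h7
    exact h7
  have h8 : (φ ((1 - z) * p)).re ≤ 1 / n := by
    rw [le_div_iff₀ hn', mul_comm]
    have hcz : (1 - z) ∈ Subalgebra.center ℂ (NG G) := sub_mem (one_mem _) hzc
    refine hφ.nat_mul_le_one (hz.one_sub.mul hp (center_comm hcz p).symm) n ?_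
    have h9 : (centerExp G ((1 - z) * p) : NG G) = (1 - z) * b :=
      congrArg Subtype.val (centerExp_center_mul ⟨1 - z, hcz⟩ p)
    have h10 : (1 - (n : ℂ) • ((1 - z) * b) : NG G) =
        ((n : ℝ) : ℂ) • ((1 - z) * (((1 / n : ℝ) : ℂ) • 1 - b)) + z := by
      have : ((n : ℝ) : ℂ) * ((1 / n : ℝ) : ℂ) = 1 := by
        rw [← Complex.ofReal_mul, mul_one_div_cancel hn'.ne', Complex.ofReal_one]
      rw [mul_sub, smul_sub, mul_smul_comm, mul_one, smul_smul, this, one_smul,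
        Complex.ofReal_natCast]
      abel
    rw [h9, h10]
    exact (isPositive_smul h2 hn'.le).add (isPositive_of_isStarProjection hz)
  have h11 : φ p = φ (z * p) + φ ((1 - z) * p) := by
    rw [← map_add, ← add_mul, add_sub_cancel, one_mul]
  rw [h11, Complex.add_re]
  linarith

theorem trG_projection_re {p : NG G} (hp : IsStarProjection p) : (trG p).re = ‖vec p‖ ^ 2 := by
  have h := trG_star_mul_self p
  rw [hp.isSelfAdjoint.star_eq, hp.isIdempotentElem] at h
  rw [h]
  exact_mod_cast rfl

theorem isPositive_smul_one_sub {y : NG G} (hy : IsSelfAdjoint y) {M : ℝ}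
    (hM : ‖(y : BL2 G)‖ ≤ M) : (((M : ℂ) • 1 - y : NG G) : BL2 G).IsPositive := by
  have hy' : IsSelfAdjoint (y : BL2 G) := congrArg Subtype.val hy
  have h1 := hy'.le_algebraMap_norm_self
  rw [ContinuousLinearMap.le_def] at h1
  have h2 : (((M - ‖(y : BL2 G)‖ : ℝ) : ℂ) • (1 : BL2 G)).IsPositive :=
    ContinuousLinearMap.isPositive_one.smul_of_nonneg
      (Complex.zero_le_real.mpr (sub_nonneg.mpr hM))
  convert h1.add h2 using 1
  change (M : ℂ) • (1 : BL2 G) - (y : BL2 G) = _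
  rw [Algebra.algebraMap_eq_smul_one, ← Complex.coe_smul, Complex.ofReal_sub, sub_smul]
  abel

/-- The functional is controlled by the Hilbert space norm on bounded sets. -/
theorem ExtendsCentralTrace.selfAdjoint_le (hφ : ExtendsCentralTrace φ) {y : NG G}
    (hy : IsSelfAdjoint y) {M : ℝ} (hM : ‖(y : BL2 G)‖ ≤ M) {ε : ℝ} (hε : 0 < ε) {n : ℕ}
    (hn : 0 < n) : (φ y).re ≤ ε + M * (n * (‖vec y‖ / ε) ^ 2 + 1 / n) := by
  -- Cutting y at height ε, the part below contributes at most ε and the part above at most M·φ(p).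
  obtain ⟨p, hp, h1, h2, hpy, -⟩ := exists_spectral_projection hy ε
  have hM0 : 0 ≤ M := (norm_nonneg _).trans hM
  have h3 : (φ ((1 - p) * y)).re ≤ ε := by
    have h4 := hφ.re_nonneg _ h2
    rw [mul_sub, mul_smul_comm, mul_one, map_sub, Complex.sub_re, re_smul_map, map_sub,
      hφ.map_one, Complex.sub_re, Complex.one_re] at h4
    have h5 := hφ.re_nonneg _ (isPositive_of_isStarProjection hp)
    nlinarith
  have h6 : (φ (p * y)).re ≤ M * (φ p).re := by
    have h7 := hφ.re_nonneg _ (isPositive_projection_mul hp (isPositive_smul_one_sub hy hM) (by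
      rw [mul_sub, sub_mul, hpy]; simp))
    rw [mul_sub, mul_smul_comm, mul_one, map_sub, Complex.sub_re, re_smul_map] at h7
    linarith
  -- Chebyshev in ‖·‖₂: ε‖p‖₂² ≤ tr(py) ≤ ‖p‖₂‖y‖₂.
  have h8 : (trG p).re ≤ (‖vec y‖ / ε) ^ 2 := by
    have h9 := (ExtendsCentralTrace.trG_self (G := G)).re_nonneg _ h1
    rw [mul_sub, mul_smul_comm, mul_one, map_sub, Complex.sub_re, re_smul_map, trGₗ_apply,
      trGₗ_apply, trG_mul, hp.isSelfAdjoint.star_eq] at h9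
    have h10 : (inner ℂ (vec p) (vec y) : ℂ).re ≤ ‖vec p‖ * ‖vec y‖ :=
      (Complex.re_le_norm _).trans (norm_inner_le_norm _ _)
    rw [trG_projection_re hp] at h9 ⊢
    have h11 : ε * ‖vec p‖ ≤ ‖vec y‖ := by
      by_cases h0 : ‖vec p‖ = 0
      · rw [h0, mul_zero]; exact norm_nonneg _
      · have hpos : 0 < ‖vec p‖ := lt_of_le_of_ne (norm_nonneg _) (Ne.symm h0)
        refine le_of_mul_le_mul_right ?_ hpos
        nlinarith
    gcongr
    rw [le_div_iff₀ hε]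
    linarith
  have h12 := hφ.projection_le hp hn
  have h13 : φ y = φ (p * y) + φ ((1 - p) * y) := by
    rw [← map_add, ← add_mul, add_sub_cancel, one_mul]
  rw [h13, Complex.add_re]
  have h14 : (φ p).re ≤ n * (‖vec y‖ / ε) ^ 2 + 1 / n := by
    refine h12.trans ?_
    gcongr
  have h15 := mul_le_mul_of_nonneg_left h14 hM0
  linarith

theorem ExtendsCentralTrace.conjVN (hφ : ExtendsCentralTrace φ) (g : G) (a : NG G) :
    φ (conjVN g a) = φ a := by
  rw [CenterAtiyah.conjVN, hφ.tracial, ← mul_assoc, ← _root_.map_mul]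
  simp

/-- E(a) is approximated in ‖·‖₂ by positive b with ‖b‖ ≤ ‖a‖ and φ(b) = φ(a), while φ(E(a)) =
tr(a). The estimate for self-adjoint elements, applied to both signs of E(a) − b, closes the gap. -/
theorem ExtendsCentralTrace.re_eq_of_isPositive (hφ : ExtendsCentralTrace φ) {a : NG G}
    (ha : (a : BL2 G).IsPositive) : (φ a).re = (trG a).re := by
  set M : ℝ := ‖(a : BL2 G)‖ + ‖(a : BL2 G)‖ with hM
  have hM0 : 0 ≤ M := by positivity
  have hEpos := isPositive_centerExp ha
  have key : ∀ ε : ℝ, 0 < ε → ∀ n : ℕ, 0 < n →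
      |(φ a).re - (trG a).re| ≤ ε + M * (1 / n + 1 / n) := by
    intro ε hε n hn
    have hn' : (0 : ℝ) < n := by exact_mod_cast hn
    have h := starProjection_vec_mem_closure
      (S := {b : NG G | ‖(b : BL2 G)‖ ≤ ‖(a : BL2 G)‖ ∧ (b : BL2 G).IsPositive ∧ φ b = φ a})
      (fun x hx y hy s t hs ht hst =>
        ⟨norm_convex_le hx.1 hy.1 hs ht hst, isPositive_convex hx.2.1 hy.2.1 hs ht, by
          rw [map_add, map_smul, map_smul, hx.2.2, hy.2.2, ← add_smul, ← Complex.ofReal_add, hst,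
            Complex.ofReal_one, one_smul]⟩)
      (fun g x hx => ⟨(norm_conjVN_le g x).trans hx.1, isPositive_conjVN g hx.2.1, by
        rw [hφ.conjVN, hx.2.2]⟩)
      (a := a) ⟨le_rfl, ha, rfl⟩
    rw [← vec_centerExp, Metric.mem_closure_iff] at h
    -- Distance ε/n turns the term n(‖·‖₂/ε)² into at most 1/n.
    obtain ⟨_, ⟨b, hb, rfl⟩, hdist⟩ := h (ε / n) (by positivity)
    set E : NG G := (centerExp G a : NG G) with hE
    have hφE : φ E = trG a := by rw [hφ.center E (centerExp G a).2, trG_centerExp]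
    have hbound : ∀ y : NG G, ‖vec y‖ ≤ ε / n → M * (n * (‖vec y‖ / ε) ^ 2 + 1 / n) ≤
        M * (1 / n + 1 / n) := by
      intro y hy
      have : ‖vec y‖ / ε ≤ 1 / n := by
        rw [div_le_iff₀ hε]
        exact hy.trans_eq (by ring)
      have h2 : (n : ℝ) * (‖vec y‖ / ε) ^ 2 ≤ 1 / n := by
        calc (n : ℝ) * (‖vec y‖ / ε) ^ 2 ≤ (n : ℝ) * (1 / n : ℝ) ^ 2 := by gcongr
          _ = (1 / n : ℝ) := by field_simp
      gcongr
    have hsb : star b = b := star_eq_of_isPositive hb.2.1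
    have hsE : star E = E := star_eq_of_isPositive hEpos
    have hdist' : ‖vec (E - b)‖ ≤ ε / n := by
      rw [vec_sub, ← dist_eq_norm]
      exact hdist.le
    have hdist'' : ‖vec (b - E)‖ ≤ ε / n := by
      rw [vec_sub, norm_sub_rev, ← vec_sub]
      exact hdist'
    have hn1 : ‖((E - b : NG G) : BL2 G)‖ ≤ M :=
      (norm_sub_le _ _).trans (add_le_add (norm_centerExp_le a) hb.1)
    have hn2 : ‖((b - E : NG G) : BL2 G)‖ ≤ M :=
      (norm_sub_le _ _).trans (add_le_add hb.1 (norm_centerExp_le a))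
    have e1 := (hφ.selfAdjoint_le (y := E - b) (by rw [IsSelfAdjoint, star_sub, hsb, hsE]) hn1 hε
      hn).trans (add_le_add le_rfl (hbound _ hdist'))
    have e2 := (hφ.selfAdjoint_le (y := b - E) (by rw [IsSelfAdjoint, star_sub, hsb, hsE]) hn2 hε
      hn).trans (add_le_add le_rfl (hbound _ hdist''))
    rw [map_sub, Complex.sub_re, hφE, hb.2.2] at e1 e2
    rw [abs_le]
    constructor <;> linarith
  have h0 : |(φ a).re - (trG a).re| ≤ 0 := by
    refine le_of_forall_pos_le_add fun η hη => ?_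
    obtain ⟨n, hn⟩ := exists_nat_gt (4 * (M + 1) / η)
    have hn' : (0 : ℝ) < n := lt_of_le_of_lt (by positivity) hn
    have h1 := key (η / 2) (by positivity) n (by exact_mod_cast hn')
    rw [div_lt_iff₀ hη] at hn
    have h2 : M * (1 / n + 1 / n) ≤ η / 2 := by
      rw [show M * (1 / n + 1 / n : ℝ) = 2 * M / n by ring, div_le_iff₀ hn']
      nlinarith
    linarith
  exact sub_eq_zero.mp (abs_eq_zero.mp (le_antisymm h0 (abs_nonneg _)))

theorem ExtendsCentralTrace.eq_of_isPositive (hφ : ExtendsCentralTrace φ) {a : NG G}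
    (ha : (a : BL2 G).IsPositive) : φ a = trG a :=
  Complex.ext (hφ.re_eq_of_isPositive ha) (by
    rw [← (Complex.nonneg_iff.mp (hφ.nonneg a ha)).2, ← (Complex.nonneg_iff.mp (trG_nonneg ha)).2])

theorem ExtendsCentralTrace.eq_of_isSelfAdjoint (hφ : ExtendsCentralTrace φ) {a : NG G}
    (ha : IsSelfAdjoint a) : φ a = trG a := by
  have h := hφ.eq_of_isPositive (isPositive_smul_one_sub ha le_rfl)
  rw [← trGₗ_apply, map_sub, map_sub, map_smul, map_smul, hφ.map_one,
    ExtendsCentralTrace.trG_self.map_one] at h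
  exact sub_right_injective h

/-- A positive tracial functional is determined by its values on the center. -/
theorem ExtendsCentralTrace.eq_trG (hφ : ExtendsCentralTrace φ) (a : NG G) : φ a = trG a := by
  have h1 := hφ.eq_of_isSelfAdjoint (realPart a).2
  have h2 := hφ.eq_of_isSelfAdjoint (imaginaryPart a).2
  rw [← realPart_add_I_smul_imaginaryPart a, ← trGₗ_apply, map_add, map_add, map_smul, map_smul,
    h1, h2]
  rfl

/-- The canonical trace factors through the center-valued trace. -/
theorem trG_trU (a : NG G) : trG (trU G a : NG G) = trG a := by
  have hτ := isCenterValuedTrace_trU (G := G)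
  have hφ : ExtendsCentralTrace
      ((trGₗ G).comp ((Subalgebra.center ℂ (NG G)).val.toLinearMap.comp (trU G))) := by
    refine ⟨fun a b => ?_, fun c hc => ?_, fun a ha => trG_nonneg (hτ.positive a ha)⟩
    · change trG (trU G (a * b) : NG G) = trG (trU G (b * a) : NG G)
      rw [hτ.tracial]
    · change trG (trU G c : NG G) = trG c
      rw [hτ.map_center ⟨c, hc⟩]
  exact hφ.eq_trG a

end Uniqueness

/-! ### Integrality for finite subgroups and the conclusion -/

section FiniteSubgroups

/-- The coefficient at the identity of an idempotent of the group algebra of a finite group `H` is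
an integral multiple of `1 / |H|`. -/
theorem exists_nat_eq_card_mul_coeff_one {H : Type u} [Group H] [Finite H] {q : MonoidAlgebra ℂ H}
    (hq : q * q = q) : ∃ k : ℕ, (Nat.card H : ℂ) * q.coeff 1 = k := by
  classical
  have := Fintype.ofFinite H
  set T : MonoidAlgebra ℂ H →ₗ[ℂ] MonoidAlgebra ℂ H := LinearMap.mulLeft ℂ q with hT
  have hidem : IsIdempotentElem T := by
    rw [IsIdempotentElem, hT, Module.End.mul_eq_comp, ← LinearMap.mulLeft_mul, hq]
  set b := MonoidAlgebra.basis H ℂ with hb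
  have : Module.Finite ℂ (MonoidAlgebra ℂ H) := Module.Finite.of_basis b
  -- The trace of an idempotent operator is its rank. In the basis H every diagonal entry of left
  -- multiplication by q is q(1), so the same trace is |H|·q(1).
  refine ⟨Module.finrank ℂ T.range, ?_⟩
  rw [← (LinearMap.IsIdempotentElem.isProj_range T hidem).trace,
    LinearMap.trace_eq_matrix_trace ℂ b, Matrix.trace]
  have hdiag : ∀ h : H, (LinearMap.toMatrix b b T).diag h = q.coeff 1 := by
    intro h
    rw [Matrix.diag_apply, LinearMap.toMatrix_apply]
    change (q * b h).coeff h = _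
    have : b h = MonoidAlgebra.single h 1 := by simp [hb]
    rw [this, MonoidAlgebra.coeff_mul_single_eq_coeff_mul 1 (by simp), mul_one]
  rw [Finset.sum_congr rfl fun h _ => hdiag h, Finset.sum_const, Finset.card_univ,
    Nat.card_eq_fintype_card, nsmul_eq_mul]

variable {G : Type u} [Group G]

/-- The embedding `ℂ[H] → N(G)` for a subgroup `H` of `G`. -/
def subgroupAlgebraToVN (H : Subgroup G) : MonoidAlgebra ℂ H →ₐ[ℂ] NG G :=
  MonoidAlgebra.lift ℂ (NG G) H ((leftRegularVN G).comp H.subtype)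

theorem groupRingToVN_mapDomain (H : Subgroup G) (R : Subring ℂ) (p : MonoidAlgebra R H) :
    groupRingToVN G R (MonoidAlgebra.mapDomainRingHom _ H.subtype p) =
      subgroupAlgebraToVN H (MonoidAlgebra.mapRingHom H R.subtype p) := by
  induction p using MonoidAlgebra.induction_linear with
  | zero => simp
  | add x y hx hy => rw [map_add, map_add, map_add, map_add, hx, hy]
  | single h r => simp [groupRingToVN, subgroupAlgebraToVN, MonoidAlgebra.lift_single]

theorem vec_subgroupAlgebraToVN (H : Subgroup G) (q : MonoidAlgebra ℂ H) (h : H) :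
    vec (subgroupAlgebraToVN H q) h = q.coeff h := by
  classical
  induction q using MonoidAlgebra.induction_linear with
  | zero => simp [← vecₗ_apply]
  | add x y hx hy =>
    rw [map_add, vec_add, MonoidAlgebra.coeff_add, Finsupp.add_apply, ← hx, ← hy]
    rfl
  | single k r =>
    rw [subgroupAlgebraToVN, MonoidAlgebra.lift_single, vec_smul]
    change r * (leftRegular G (k : G) (delta 1) : L2 G) h = _
    rw [leftRegular_delta, mul_one, MonoidAlgebra.coeff_single]
    by_cases hk : k = h
    · subst hk
      simp [delta_apply_self]
    · rw [delta_apply_of_ne (fun h' => hk (Subtype.ext h'.symm)),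
        Finsupp.single_eq_of_ne (Ne.symm hk), mul_zero]

/-- Lets idempotency in N(G) be pulled back to ℂ[H], where finite-dimensional linear algebra
applies. -/
theorem subgroupAlgebraToVN_injective (H : Subgroup G) :
    Function.Injective (subgroupAlgebraToVN H) := by
  intro x y hxy
  rw [← MonoidAlgebra.coeff_inj]
  ext h
  rw [← vec_subgroupAlgebraToVN, ← vec_subgroupAlgebraToVN, hxy]

theorem exists_nat_eq_card_mul_trG (H : Subgroup G) [Finite H] {R : Subring ℂ}
    {p : MonoidAlgebra R H}
    (hP : IsIdempotentElem (groupRingToVN G R (MonoidAlgebra.mapDomainRingHom _ H.subtype p))) :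
    ∃ k : ℕ, (Nat.card H : ℂ) *
      trG (groupRingToVN G R (MonoidAlgebra.mapDomainRingHom _ H.subtype p)) = k := by
  rw [groupRingToVN_mapDomain] at hP ⊢
  obtain ⟨k, hk⟩ := exists_nat_eq_card_mul_coeff_one
    (subgroupAlgebraToVN_injective H ((map_mul _ _ _).trans hP))
  refine ⟨k, ?_⟩
  rw [trG_eq, ← hk, ← vec_subgroupAlgebraToVN]
  rfl

/-- The factorial of the bound is a common multiple, so the infimum is attained and is not the
default value 0. -/
theorem lcmFin_spec (hG : BoundedFiniteSubgroups G) :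
    0 < lcmFin G ∧ ∀ H : Subgroup G, Finite H → Nat.card H ∣ lcmFin G := by
  obtain ⟨B, hB⟩ := hG
  refine Nat.sInf_mem (s := {m : ℕ | 0 < m ∧ ∀ H : Subgroup G, Finite H → Nat.card H ∣ m})
    ⟨B.factorial, B.factorial_pos, fun H hH => ?_⟩
  exact Nat.dvd_factorial Nat.card_pos (hB H hH)

theorem exists_int_lcmFin_mul_trG (hG : BoundedFiniteSubgroups G) {K : Subring ℂ} {z : ZNG G}
    (hz : z ∈ LK K G) : ∃ k : ℤ, (lcmFin G : ℂ) * trG (z : NG G) = k := by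
  induction hz using AddSubgroup.closure_induction with
  | mem z hz =>
    obtain ⟨H, hH, p, P, rfl, hP, rfl⟩ := hz
    obtain ⟨k, hk⟩ := exists_nat_eq_card_mul_trG H hP.isIdempotentElem
    obtain ⟨m, hm⟩ := (lcmFin_spec hG).2 H hH
    refine ⟨m * k, ?_⟩
    rw [trG_trU, hm]
    push_cast
    rw [← hk]
    ring
  | zero => exact ⟨0, by
    rw [show trG ((0 : ZNG G) : NG G) = 0 from map_zero (trGₗ G), mul_zero, Int.cast_zero]⟩
  | add x y _ _ hx hy =>
    obtain ⟨k, hk⟩ := hx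
    obtain ⟨l, hl⟩ := hy
    refine ⟨k + l, ?_⟩
    have : trG ((x + y : ZNG G) : NG G) = trG (x : NG G) + trG (y : NG G) := map_add (trGₗ G) _ _
    rw [this, mul_add, hk, hl]
    push_cast
    rfl
  | neg x _ hx =>
    obtain ⟨k, hk⟩ := hx
    refine ⟨-k, ?_⟩
    have : trG ((-x : ZNG G) : NG G) = -trG (x : NG G) := map_neg (trGₗ G) _
    rw [this, mul_neg, hk]
    push_cast
    rfl

theorem trG_dimUKer {n : ℕ} (T : Matrix (Fin n) (Fin n) (NG G)) :
    trG (dimUKer T : NG G) = dimGKer T := by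
  have h : trG (dimUKer T : NG G) = ∑ i, trG (trU G (kerProj T i i) : NG G) :=
    map_sum ((trGₗ G).comp (Subalgebra.center ℂ (NG G)).val.toLinearMap) _ _
  rw [h, dimGKer]
  exact Finset.sum_congr rfl fun i _ => trG_trU _

end FiniteSubgroups

end CenterAtiyah

end

theorem mainTheorem9 (G : Type*) [Group G] (K : Subring ℂ)
    (hG : CenterAtiyah.BoundedFiniteSubgroups G)
    (hK : ∀ z ∈ CenterAtiyah.fracField K, (starRingEnd ℂ) z ∈ CenterAtiyah.fracField K)
    (h : CenterAtiyah.CenterValuedAtiyahConjecture K G) :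
    CenterAtiyah.StrongAtiyahConjecture K G := by
  intro n A
  obtain ⟨k, hk⟩ := CenterAtiyah.exists_int_lcmFin_mul_trG hG (h n A)
  have hpos : (CenterAtiyah.lcmFin G : ℂ) ≠ 0 := by
    exact_mod_cast (CenterAtiyah.lcmFin_spec hG).1.ne'
  refine ⟨k, ?_⟩
  rw [← hk, CenterAtiyah.trG_dimUKer, one_div, inv_mul_cancel_left₀ hpos]
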